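/- Let $p \ge 3$ be a prime number and let $E$ be a finite field of characteristic $p$ such that $E = \mathbb{F}_p(z)$ for some element $z \in E$ with $z \neq 0$. Let $G$ be the subgroup of $\mathrm{SL}_2(E)$ generated by the two matrices $$\begin{pmatrix} 0 & 1 \\ -1 & 2 \end{pmatrix} \quad\text{and}\quad \begin{pmatrix} 1 & z \\ 0 & 1 \end{pmatrix}.$$ Then: (i) if $p = 3$ and $z^2 = 2$ in $E$, then $G \cong \mathrm{SL}_2(\mathbb{F}_5)$; (ii) otherwise, $G = \mathrm{SL}_2(E)$ (in particular $G \cong \mathrm{SL}_2(E)$). -/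

import Mathlib

/-- The element `[[0, 1], [-1, 2]]` of `SL₂(R)`. -/
def matV (R : Type*) [CommRing R] : Matrix.SpecialLinearGroup (Fin 2) R :=
  ⟨!![0, 1; -1, 2], by simp [Matrix.det_fin_two]⟩

/-- The element `[[1, z], [0, 1]]` of `SL₂(R)`. -/
def matU {R : Type*} [CommRing R] (z : R) : Matrix.SpecialLinearGroup (Fin 2) R :=
  ⟨!![1, z; 0, 1], by simp [Matrix.det_fin_two]⟩

/-- The subgroup of `SL₂(R)` generated by `[[0, 1], [-1, 2]]` and `[[1, z], [0, 1]]`. -/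
def groupG {R : Type*} [CommRing R] (z : R) : Subgroup (Matrix.SpecialLinearGroup (Fin 2) R) :=
  Subgroup.closure {matV R, matU z}

/-!
After adjoining `-1`, let `H` be the group generated by the two matrices, acting on the projective
line over `E`. The matrices of `H` that fix the point at infinity and are unipotent form a group
isomorphic to an additive subgroup `A` of `E` (`rootGroup`), of order `q` say; it contains `z`. The
heart of the proof is that the orbit of infinity has exactly `q + 1` points, apart from one
exceptional configuration.

This is a class equation. In `SL₂` the centralizer of every noncentral element is commutative, so
the noncentral elements of `H` are partitioned into cells: the cell of `x` consists of the conjugates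
of the noncentral elements of its centralizer `C`, and it has `|H| (|C| - |Z|) / |N(C)|` elements
(`CentralizersCommute.card_centralizerCell_mul`), where `Z` is the centre.
* All noncentral elements of trace `±2` form one cell: the orbit of infinity has `1 + q f` points,
  so every `p`-element fixes a point in it (`Admissible.mem_cell_unip`). The normalizer of the
  corresponding centralizer is the upper triangular subgroup of `H`, of order `2 q d`.
* If `d > 1`, a generator of the group of diagonal entries of the upper triangular matrices gives a
  cell whose centralizer has order `2 d` (`Admissible.exists_torus`), and `d < q`.
* Any other cell belongs to a semisimple element, so its centralizer has index `1` or `2` in its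
  normalizer and it contains at least a quarter of `H`.
Comparing proportions, there is exactly one cell of the last kind, and its size then forces
`f = 1`, or `q = 3`, `d = 2`, `f = 3` (`Admissible.card_finiteOrbit_or_exceptional`).

If `f = 1`, the orbit of infinity is `A ∪ {∞}`. Since it is stable under `x ↦ 1 / (2 - x)`, the
group `A` contains `1` and is closed under inversion; Hua's identity makes it a subfield, and as it
contains `z` it is `E`. So `H` contains all transvections `[[1, a], [0, 1]]`, whose odd order
puts them into the original group, and with the first generator they generate `SL₂(E)`.

In the exceptional configuration `p = 3`, and a noncentral element of `H` has trace `±2` or has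
order dividing `4` or `10`. Applied to the products of the first generator with the
second and its inverse, of traces `2 ± z`, this gives `z² = 2` (`eq_of_exceptional`). Conversely, for
`p = 3` and `z² = 2` an explicit embedding of `SL₂(𝔽₅)` into `SL₂(𝔽₉)`, written down on Bruhat
decompositions, has the group generated by the two matrices as its image (`icoHom_range`).
-/

open Matrix MatrixGroups

/-! ### Finite groups in which centralizers of noncentral elements are abelian -/

/-- The centralizers of the noncentral elements of `H` are commutative. -/
def CentralizersCommute (H : Type*) [Group H] : Prop :=
  ∀ x : H, x ∉ Subgroup.center H → ∀ a b : H, Commute a x → Commute b x → Commute a b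

/-- The noncentral elements that are conjugate to an element of the centralizer of `x`. -/
def centralizerCell {H : Type*} [Group H] (x : H) : Set H :=
  {y | y ∉ Subgroup.center H ∧ ∃ h : H, h * y * h⁻¹ ∈ Subgroup.centralizer {x}}

section Cells

variable {H : Type*} [Group H]

theorem mem_centralizer_singleton_iff_commute {x y : H} :
    y ∈ Subgroup.centralizer {x} ↔ Commute y x := by
  rw [Subgroup.mem_centralizer_singleton_iff]; exact Iff.rfl

theorem conj_mem_center_iff {x : H} (h : H) :
    h * x * h⁻¹ ∈ Subgroup.center H ↔ x ∈ Subgroup.center H := by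
  refine ⟨fun hx => ?_, fun hx => Subgroup.Normal.conj_mem inferInstance x hx h⟩
  have := Subgroup.Normal.conj_mem inferInstance _ hx h⁻¹
  simpa [mul_assoc] using this

theorem self_mem_centralizerCell {x : H} (hx : x ∉ Subgroup.center H) :
    x ∈ centralizerCell x :=
  ⟨hx, 1, by rw [mem_centralizer_singleton_iff_commute]; simp⟩

theorem CentralizersCommute.centralizer_eq (hH : CentralizersCommute H) {x y : H}
    (hx : x ∉ Subgroup.center H) (hy : y ∉ Subgroup.center H) (hxy : Commute x y) :
    Subgroup.centralizer {x} = Subgroup.centralizer {y} := by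
  ext a
  simp only [mem_centralizer_singleton_iff_commute]
  exact ⟨fun ha => hH x hx a y ha hxy.symm, fun ha => hH y hy a x ha hxy⟩

theorem mem_centralizer_conj_iff {x y : H} (h : H) :
    h * y * h⁻¹ ∈ Subgroup.centralizer {h * x * h⁻¹} ↔ y ∈ Subgroup.centralizer {x} := by
  simp only [mem_centralizer_singleton_iff_commute]
  exact Commute.conj_iff h

theorem CentralizersCommute.centralizerCell_subset (hH : CentralizersCommute H) {x y : H}
    (hx : x ∉ Subgroup.center H) (hy : y ∈ centralizerCell x) :
    centralizerCell y ⊆ centralizerCell x := by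
  obtain ⟨hy0, h, hh⟩ := hy
  rintro w ⟨hw, k, hk⟩
  refine ⟨hw, h * k, ?_⟩
  have h1 : Subgroup.centralizer {x} = Subgroup.centralizer {h * y * h⁻¹} :=
    hH.centralizer_eq hx (by rwa [conj_mem_center_iff])
      (mem_centralizer_singleton_iff_commute.1 hh).symm
  rw [h1]
  have := (mem_centralizer_conj_iff (x := y) h).2 hk
  simpa [mul_assoc] using this

theorem mem_centralizerCell_symm {x y : H}
    (hx : x ∉ Subgroup.center H) (hy : y ∈ centralizerCell x) :
    x ∈ centralizerCell y := by
  obtain ⟨_, h, hh⟩ := hy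
  refine ⟨hx, h⁻¹, ?_⟩
  rw [← mem_centralizer_conj_iff h]
  simp only [mem_centralizer_singleton_iff_commute] at hh ⊢
  simpa [mul_assoc] using hh.symm

theorem CentralizersCommute.disjoint_centralizerCell (hH : CentralizersCommute H) {x y : H}
    (hx : x ∉ Subgroup.center H) (hy : y ∉ Subgroup.center H) (hxy : y ∉ centralizerCell x) :
    Disjoint (centralizerCell x) (centralizerCell y) := by
  rw [Set.disjoint_left]
  intro w hwx hwy
  exact hxy (hH.centralizerCell_subset hx hwx (mem_centralizerCell_symm hy hwy))

/-- Counting pairs `(h, m)` with `m` a noncentral element of the centralizer of `x`: the fibre of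
`(h, m) ↦ h m h⁻¹` over each point of the cell is a coset of the normalizer. -/
theorem CentralizersCommute.card_centralizerCell_mul [Finite H] (hH : CentralizersCommute H)
    {x : H} (hx : x ∉ Subgroup.center H) :
    Nat.card (centralizerCell x) * Nat.card (Subgroup.normalizer (Subgroup.centralizer {x} : Set H))
      + Nat.card H * Nat.card (Subgroup.center H)
      = Nat.card H * Nat.card (Subgroup.centralizer {x}) := by
  classical
  set C := Subgroup.centralizer {x} with hC
  set M : Set H := (C : Set H) \ (Subgroup.center H : Set H) with hM
  have hZC : Subgroup.center H ≤ C := Subgroup.center_le_centralizer _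
  have hMcard : Nat.card M + Nat.card (Subgroup.center H) = Nat.card C := by
    have := Set.ncard_sdiff_add_ncard_of_subset (s := (Subgroup.center H : Set H))
      (t := (C : Set H)) hZC
    exact this
  -- every point of the cell determines an element moving it into the centralizer
  have hch : ∀ y : centralizerCell x, ∃ h : H, h * y * h⁻¹ ∈ C := fun y => y.2.2
  choose k hk using hch
  have hcent : ∀ m : H, m ∈ M → Subgroup.centralizer {m} = C := fun m hm =>
    hH.centralizer_eq hm.2 hx (mem_centralizer_singleton_iff_commute.1 hm.1)
  have hnorm : ∀ h m : H, m ∈ M → h * m * h⁻¹ ∈ M →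
      h ∈ Subgroup.normalizer (C : Set H) := by
    intro h m hm hm'
    rw [Subgroup.mem_normalizer_iff]
    intro n
    have := mem_centralizer_conj_iff (x := m) (y := n) h
    rw [hcent _ hm, hcent _ hm'] at this
    exact this.symm
  have hconjM : ∀ h m : H, m ∈ M → h ∈ Subgroup.normalizer (C : Set H) → h * m * h⁻¹ ∈ M := by
    intro h m hm hh
    exact ⟨(Subgroup.mem_normalizer_iff.1 hh m).1 hm.1, by
      change _ ∉ Subgroup.center H
      rw [conj_mem_center_iff]; exact hm.2⟩
  have hkM : ∀ y : centralizerCell x, k y * y * (k y)⁻¹ ∈ M := fun y =>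
    ⟨hk y, by change _ ∉ Subgroup.center H; rw [conj_mem_center_iff]; exact y.2.1⟩
  let e : (H × M) ≃ (centralizerCell x × Subgroup.normalizer (C : Set H)) :=
    { toFun := fun a =>
        let y : centralizerCell x := ⟨a.1 * a.2 * a.1⁻¹, by
          refine ⟨by rw [conj_mem_center_iff]; exact a.2.2.2, a.1⁻¹, ?_⟩
          simpa [mul_assoc] using a.2.2.1⟩
        (y, ⟨k y * a.1, hnorm _ a.2 a.2.2 (by
          have := hkM y
          simpa [y, mul_assoc] using this)⟩)
      invFun := fun b => ((k b.1)⁻¹ * b.2, ⟨(b.2 : H)⁻¹ * (k b.1 * b.1 * (k b.1)⁻¹) * b.2, by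
          have := hconjM (b.2 : H)⁻¹ _ (hkM b.1) (inv_mem b.2.2)
          simpa using this⟩)
      left_inv := by
        rintro ⟨h, m⟩
        ext <;> simp [mul_assoc]
      right_inv := by
        rintro ⟨y, n⟩
        have hy : ∀ w : centralizerCell x, (w : H) = y → k w = k y := by
          intro w hw; rw [Subtype.ext hw]
        ext
        · simp [mul_assoc]
        · simp only
          rw [hy]
          · simp
          · simp [mul_assoc] }
  have := Nat.card_congr e
  rw [Nat.card_prod, Nat.card_prod] at this
  rw [← this, ← hMcard]
  ring

theorem CentralizersCommute.sum_card_centralizerCell_le [Finite H] (hH : CentralizersCommute H)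
    (S : Finset H) (hS : ∀ x ∈ S, x ∉ Subgroup.center H)
    (hd : ∀ x ∈ S, ∀ y ∈ S, x ≠ y → y ∉ centralizerCell x) :
    ∑ x ∈ S, Nat.card (centralizerCell x) + Nat.card (Subgroup.center H) ≤ Nat.card H := by
  classical
  have := Fintype.ofFinite H
  have h1 : (∑ x ∈ S, Nat.card (centralizerCell x))
      = (S.biUnion fun x => (centralizerCell x).toFinset).card := by
    rw [Finset.card_biUnion]
    · refine Finset.sum_congr rfl fun x _ => ?_
      rw [Nat.card_eq_fintype_card, Set.toFinset_card]
    · intro x hx y hy hxy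
      rw [Function.onFun, Set.disjoint_toFinset]
      exact hH.disjoint_centralizerCell (hS x hx) (hS y hy) (hd x hx y hy hxy)
  have h2 : Nat.card (Subgroup.center H) = (Subgroup.center H : Set H).toFinset.card := by
    rw [Set.toFinset_card, ← Nat.card_eq_fintype_card]; rfl
  rw [h1, h2, Nat.card_eq_fintype_card, ← Finset.card_union_of_disjoint]
  · exact Finset.card_le_univ _
  · rw [Finset.disjoint_left]
    intro w hw hw'
    simp only [Finset.mem_biUnion, Set.mem_toFinset] at hw hw'
    obtain ⟨x, _, hx⟩ := hw
    exact hx.1 hw'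

theorem card_le_sum_card_centralizerCell [Finite H] (S : Finset H)
    (hS : ∀ y, y ∉ Subgroup.center H → ∃ x ∈ S, y ∈ centralizerCell x) :
    Nat.card H ≤ ∑ x ∈ S, Nat.card (centralizerCell x) + Nat.card (Subgroup.center H) := by
  classical
  have := Fintype.ofFinite H
  have h2 : (Finset.univ : Finset H) ⊆ (S.biUnion fun x => (centralizerCell x).toFinset)
      ∪ (Subgroup.center H : Set H).toFinset := by
    intro y _
    by_cases hy : y ∈ Subgroup.center H
    · simp [hy]
    · obtain ⟨x, hx, hxy⟩ := hS y hy
      simp only [Finset.mem_union, Finset.mem_biUnion, Set.mem_toFinset]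
      exact Or.inl ⟨x, hx, hxy⟩
  calc Nat.card H = (Finset.univ : Finset H).card := by
        rw [Nat.card_eq_fintype_card, Finset.card_univ]
    _ ≤ _ := Finset.card_le_card h2
    _ ≤ _ := Finset.card_union_le _ _
    _ ≤ _ := by
        refine add_le_add (Finset.card_biUnion_le.trans (Finset.sum_le_sum fun x _ => ?_)) ?_
        · rw [Nat.card_eq_fintype_card, Set.toFinset_card]
        · rw [Set.toFinset_card, ← Nat.card_eq_fintype_card]; exact le_refl (Nat.card _)

end Cells

/-! ### Commuting elements of `SL₂` -/

namespace SLTwo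

section Ring

variable {R : Type*} [CommRing R]

theorem ext_entries {x y : SL(2, R)} (h00 : x 0 0 = y 0 0) (h01 : x 0 1 = y 0 1)
    (h10 : x 1 0 = y 1 0) (h11 : x 1 1 = y 1 1) : x = y := by
  apply Matrix.SpecialLinearGroup.ext
  intro i j
  fin_cases i <;> fin_cases j <;> assumption

theorem det_entries (x : SL(2, R)) : x 0 0 * x 1 1 - x 0 1 * x 1 0 = 1 := by
  rw [← Matrix.det_fin_two]; exact x.2

theorem mul_entry (x y : SL(2, R)) (i j : Fin 2) :
    (x * y) i j = x i 0 * y 0 j + x i 1 * y 1 j := by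
  rw [Matrix.SpecialLinearGroup.coe_mul, Matrix.mul_apply, Fin.sum_univ_two]

theorem inv_00 (x : SL(2, R)) : x⁻¹ 0 0 = x 1 1 := by
  simp [Matrix.SpecialLinearGroup.coe_inv, Matrix.adjugate_fin_two]

theorem inv_01 (x : SL(2, R)) : x⁻¹ 0 1 = -x 0 1 := by
  simp [Matrix.SpecialLinearGroup.coe_inv, Matrix.adjugate_fin_two]

theorem inv_10 (x : SL(2, R)) : x⁻¹ 1 0 = -x 1 0 := by
  simp [Matrix.SpecialLinearGroup.coe_inv, Matrix.adjugate_fin_two]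

theorem inv_11 (x : SL(2, R)) : x⁻¹ 1 1 = x 0 0 := by
  simp [Matrix.SpecialLinearGroup.coe_inv, Matrix.adjugate_fin_two]

theorem neg_entry (x : SL(2, R)) (i j : Fin 2) : (-x) i j = -x i j := by
  rw [Matrix.SpecialLinearGroup.coe_neg, Matrix.neg_apply]

theorem one_00 : (1 : SL(2, R)) 0 0 = 1 := by simp
theorem one_01 : (1 : SL(2, R)) 0 1 = 0 := by simp
theorem one_10 : (1 : SL(2, R)) 1 0 = 0 := by simp
theorem one_11 : (1 : SL(2, R)) 1 1 = 1 := by simp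

theorem matU_00 (a : R) : matU a 0 0 = 1 := by simp [matU]
theorem matU_01 (a : R) : matU a 0 1 = a := by simp [matU]
theorem matU_10 (a : R) : matU a 1 0 = 0 := by simp [matU]
theorem matU_11 (a : R) : matU a 1 1 = 1 := by simp [matU]

theorem matV_00 : matV R 0 0 = 0 := by simp [matV]
theorem matV_01 : matV R 0 1 = 1 := by simp [matV]
theorem matV_10 : matV R 1 0 = -1 := by simp [matV]
theorem matV_11 : matV R 1 1 = 2 := by simp [matV]

theorem matU_add (a b : R) : matU (a + b) = matU a * matU b := by
  apply ext_entries <;> simp [mul_entry, matU_00, matU_01, matU_10, matU_11, add_comm]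

theorem matU_zero : matU (0 : R) = 1 := by
  apply ext_entries <;> simp [matU_00, matU_01, matU_10, matU_11]

theorem matU_neg (a : R) : matU (-a) = (matU a)⁻¹ := by
  apply ext_entries <;>
    simp only [inv_00, inv_01, inv_10, inv_11, matU_00, matU_01, matU_10, matU_11, neg_zero]

/-- The matrix `[[0, -1], [1, 0]]`. -/
def matM (R : Type*) [CommRing R] : SL(2, R) := ⟨!![0, -1; 1, 0], by simp [Matrix.det_fin_two]⟩

theorem matM_00 : matM R 0 0 = 0 := by simp [matM]
theorem matM_01 : matM R 0 1 = -1 := by simp [matM]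
theorem matM_10 : matM R 1 0 = 1 := by simp [matM]
theorem matM_11 : matM R 1 1 = 0 := by simp [matM]

theorem transvection_zero_one (h : (0 : Fin 2) ≠ 1) (c : R) :
    Matrix.SpecialLinearGroup.transvection h c = matU c := by
  apply ext_entries <;> simp [Matrix.SpecialLinearGroup.transvection_coe, matU]

theorem transvection_one_zero (h : (1 : Fin 2) ≠ 0) (c : R) :
    Matrix.SpecialLinearGroup.transvection h c = matM R * matU (-c) * -matM R := by
  apply ext_entries <;>
    simp only [mul_entry, neg_entry, matU_00, matU_01, matU_10, matU_11, matM_00, matM_01, matM_10,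
      matM_11] <;>
    simp [Matrix.SpecialLinearGroup.transvection_coe]

/-- The trace of an element of `SL₂`. -/
def tr (x : SL(2, R)) : R := x 0 0 + x 1 1

theorem tr_conj (h x : SL(2, R)) : tr (h * x * h⁻¹) = tr x := by
  have := det_entries h
  simp only [tr, mul_entry, inv_00, inv_01, inv_10, inv_11]
  linear_combination (x 0 0 + x 1 1) * this

theorem tr_neg (x : SL(2, R)) : tr (-x) = -tr x := by
  simp only [tr, neg_entry]; ring

theorem commute_entries {a x : SL(2, R)} (h : Commute a x) :
    a 0 1 * x 1 0 = x 0 1 * a 1 0 ∧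
    a 0 0 * x 0 1 + a 0 1 * x 1 1 = x 0 0 * a 0 1 + x 0 1 * a 1 1 ∧
    a 1 0 * x 0 0 + a 1 1 * x 1 0 = x 1 0 * a 0 0 + x 1 1 * a 1 0 := by
  have h' : a * x = x * a := h
  have h00 := congrArg (fun m : SL(2, R) => m 0 0) h'
  have h01 := congrArg (fun m : SL(2, R) => m 0 1) h'
  have h10 := congrArg (fun m : SL(2, R) => m 1 0) h'
  simp only [mul_entry] at h00 h01 h10
  exact ⟨by linear_combination h00, h01, h10⟩

end Ring

section Field

variable {E : Type*} [Field E]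

theorem nonscalar {x : SL(2, E)} (h1 : x ≠ 1) (h2 : x ≠ -1) :
    x 0 1 ≠ 0 ∨ x 1 0 ≠ 0 ∨ x 0 0 ≠ x 1 1 := by
  by_contra! h
  obtain ⟨h01, h10, h00⟩ := h
  have hd := det_entries x
  rw [h01, h00, zero_mul, sub_zero] at hd
  rcases mul_self_eq_one_iff.1 hd with h | h
  · exact h1 (ext_entries (by rw [h00, h, one_00]) (by rw [h01, one_01])
      (by rw [h10, one_10]) (by rw [h, one_11]))
  · exact h2 (ext_entries (by rw [h00, h, neg_entry, one_00])
      (by rw [h01, neg_entry, one_01, neg_zero])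
      (by rw [h10, neg_entry, one_10, neg_zero]) (by rw [h, neg_entry, one_11]))

/-- The commutant of a nonscalar `2 × 2` matrix `x` consists of the combinations of `1` and `x`. -/
theorem exists_combination_of_commute {a x : SL(2, E)} (h1 : x ≠ 1) (h2 : x ≠ -1)
    (h : Commute a x) : ∃ α β : E, a 0 0 = α + β * x 0 0 ∧ a 0 1 = β * x 0 1 ∧
      a 1 0 = β * x 1 0 ∧ a 1 1 = α + β * x 1 1 := by
  obtain ⟨e1, e2, e3⟩ := commute_entries h
  rcases nonscalar h1 h2 with hx | hx | hx
  · refine ⟨a 0 0 - a 0 1 / x 0 1 * x 0 0, a 0 1 / x 0 1, by ring, by field_simp, ?_, ?_⟩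
    · field_simp; linear_combination -e1
    · field_simp; linear_combination -e2
  · refine ⟨a 0 0 - a 1 0 / x 1 0 * x 0 0, a 1 0 / x 1 0, by ring, ?_, by field_simp, ?_⟩
    · field_simp; linear_combination e1
    · field_simp; linear_combination e3
  · have hx' : x 0 0 - x 1 1 ≠ 0 := sub_ne_zero.2 hx
    refine ⟨a 0 0 - (a 0 0 - a 1 1) / (x 0 0 - x 1 1) * x 0 0,
      (a 0 0 - a 1 1) / (x 0 0 - x 1 1), by ring, ?_, ?_, ?_⟩
    · field_simp; linear_combination -e2
    · field_simp; linear_combination e3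
    · field_simp; ring

theorem commute_of_commute {a b x : SL(2, E)} (h1 : x ≠ 1) (h2 : x ≠ -1)
    (ha : Commute a x) (hb : Commute b x) : Commute a b := by
  obtain ⟨α, β, a1, a2, a3, a4⟩ := exists_combination_of_commute h1 h2 ha
  obtain ⟨γ, δ, b1, b2, b3, b4⟩ := exists_combination_of_commute h1 h2 hb
  apply ext_entries <;> simp only [mul_entry, a1, a2, a3, a4, b1, b2, b3, b4] <;> ring

theorem eq_or_eq_inv_of_commute {x y : SL(2, E)} (h1 : x ≠ 1) (h2 : x ≠ -1)
    (ht : tr x ^ 2 ≠ 4) (h2' : (2 : E) ≠ 0) (h : Commute y x) (hxy : tr y = tr x) :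
    y = x ∨ y = x⁻¹ := by
  obtain ⟨α, β, a1, a2, a3, a4⟩ := exists_combination_of_commute h1 h2 h
  have dx := det_entries x
  have dy := det_entries y
  rw [a1, a2, a3, a4] at dy
  simp only [tr, a1, a4] at hxy ht
  have hα : 2 * α = (1 - β) * (x 0 0 + x 1 1) := by linear_combination hxy
  have key : (1 - β) * (1 + β) * ((x 0 0 + x 1 1) ^ 2 - 4) = 0 := by
    linear_combination 4 * dy - 4 * β ^ 2 * dx - (2 * α + (1 + β) * (x 0 0 + x 1 1)) * hα
  rcases mul_eq_zero.1 key with hβ | hβ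
  · rcases mul_eq_zero.1 hβ with hβ | hβ
    · left
      have hα0 : α = 0 := by
        rw [hβ, zero_mul] at hα
        exact (mul_eq_zero.1 hα).resolve_left h2'
      have : β = 1 := by linear_combination -hβ
      subst hα0 this
      apply ext_entries <;> simp [a1, a2, a3, a4]
    · right
      have hb : β = -1 := by linear_combination hβ
      subst hb
      have hα' : α = x 0 0 + x 1 1 := by
        apply mul_left_cancel₀ h2'; linear_combination hα
      subst hα'
      apply ext_entries <;> simp [a1, a2, a3, a4, inv_00, inv_01, inv_10, inv_11]
  · exact absurd (sub_eq_zero.1 hβ) ht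

theorem eq_one_or_neg_one_of_sq {x : SL(2, E)} (h2 : (2 : E) ≠ 0) (h : x ^ 2 = 1) :
    x = 1 ∨ x = -1 := by
  by_contra! hx
  have hxx : x = x⁻¹ := by rw [eq_inv_iff_mul_eq_one, ← sq, h]
  have e00 := congrArg (fun m : SL(2, E) => m 0 0) hxx
  have e01 := congrArg (fun m : SL(2, E) => m 0 1) hxx
  have e10 := congrArg (fun m : SL(2, E) => m 1 0) hxx
  simp only [inv_00, inv_01, inv_10] at e00 e01 e10
  have z01 : x 0 1 = 0 := by
    have : 2 * x 0 1 = 0 := by linear_combination e01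
    exact (mul_eq_zero.1 this).resolve_left h2
  have z10 : x 1 0 = 0 := by
    have : 2 * x 1 0 = 0 := by linear_combination e10
    exact (mul_eq_zero.1 this).resolve_left h2
  rcases nonscalar hx.1 hx.2 with h | h | h
  · exact h z01
  · exact h z10
  · exact h e00

/-- Over a field of characteristic `p`, an element of `SL₂` of trace `2` is unipotent, so that its
`p`-th power is trivial. -/
theorem pow_char_eq_one {p : ℕ} [Fact p.Prime] [CharP E p] {y : SL(2, E)} (hy : tr y = 2) :
    y ^ p = 1 := by
  apply Subtype.ext
  rw [Matrix.SpecialLinearGroup.coe_pow, Matrix.SpecialLinearGroup.coe_one]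
  set N : Matrix (Fin 2) (Fin 2) E := (y : Matrix (Fin 2) (Fin 2) E) - 1 with hN
  have hdet := det_entries y
  simp only [tr] at hy
  have hN2 : N ^ 2 = 0 := by
    rw [sq]
    ext i j
    fin_cases i <;> fin_cases j <;> simp [hN, Matrix.mul_apply, Fin.sum_univ_two]
    · linear_combination y 0 0 * hy - hdet
    · linear_combination y 0 1 * hy
    · linear_combination y 1 0 * hy
    · linear_combination y 1 1 * hy - hdet
  have hp2 : 2 ≤ p := (Fact.out : p.Prime).two_le
  have hNp : N ^ p = 0 := pow_eq_zero_of_le hp2 hN2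
  have hy1 : (y : Matrix (Fin 2) (Fin 2) E) = N + 1 := by rw [hN]; abel
  rw [hy1, add_pow_char_of_commute p (Commute.one_right N), hNp, one_pow, zero_add]

end Field

end SLTwo

/-! ### The stabilizer of the point at infinity -/

namespace SLTwo

/-- `H` contains `-1`, a nontrivial unipotent element fixing the point at infinity, and an element
moving the point at infinity; the characteristic is not `2`. -/
structure Admissible {E : Type*} [Field E] (H : Subgroup SL(2, E)) : Prop where
  two_ne_zero : (2 : E) ≠ 0
  neg_one_mem : -1 ∈ H
  exists_matU : ∃ z : E, z ≠ 0 ∧ matU z ∈ H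
  exists_lower : ∃ v ∈ H, v 1 0 ≠ 0

/-- The additive group of those `a` for which the transvection `[[1, a], [0, 1]]` lies in `H`. -/
def rootGroup {E : Type*} [Field E] (H : Subgroup SL(2, E)) : AddSubgroup E where
  carrier := {a | matU a ∈ H}
  add_mem' := fun ha hb => by
    change matU _ ∈ H
    rw [matU_add]; exact mul_mem ha hb
  zero_mem' := by change matU _ ∈ H; rw [matU_zero]; exact one_mem H
  neg_mem' := fun ha => by
    change matU _ ∈ H
    rw [matU_neg]; exact inv_mem ha

/-- The upper triangular matrices in `H`. -/
def upper {E : Type*} [Field E] (H : Subgroup SL(2, E)) : Subgroup H where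
  carrier := {h | (h : SL(2, E)) 1 0 = 0}
  mul_mem' := fun {a b} ha hb => by
    change ((a * b : H) : SL(2, E)) 1 0 = 0
    rw [Subgroup.coe_mul, mul_entry, show (a : SL(2, E)) 1 0 = 0 from ha,
      show (b : SL(2, E)) 1 0 = 0 from hb]
    simp
  one_mem' := by
    change ((1 : H) : SL(2, E)) 1 0 = 0
    rw [Subgroup.coe_one, one_10]
  inv_mem' := fun {a} ha => by
    change ((a⁻¹ : H) : SL(2, E)) 1 0 = 0
    rw [Subgroup.coe_inv, inv_10, show (a : SL(2, E)) 1 0 = 0 from ha, neg_zero]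

/-- The character `[[t, b], [0, t⁻¹]] ↦ t` of the group of upper triangular matrices. -/
def diagChar {E : Type*} [Field E] (H : Subgroup SL(2, E)) : upper H →* Eˣ where
  toFun h := ⟨(h : SL(2, E)) 0 0, (h : SL(2, E)) 1 1, by
    have h1 := det_entries (h : SL(2, E))
    rw [show (h : SL(2, E)) 1 0 = 0 from h.2] at h1
    linear_combination h1, by
    have h1 := det_entries (h : SL(2, E))
    rw [show (h : SL(2, E)) 1 0 = 0 from h.2] at h1
    linear_combination h1⟩
  map_one' := by ext; simp
  map_mul' a b := by
    ext
    have hb : (b : SL(2, E)) 1 0 = 0 := b.2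
    simp only [Subgroup.coe_mul, mul_entry, hb, mul_zero, add_zero, Units.val_mul]

section

variable {E : Type*} [Field E] {H : Subgroup SL(2, E)}

theorem mem_rootGroup {a : E} : a ∈ rootGroup H ↔ matU a ∈ H := Iff.rfl

theorem mem_upper {h : H} : h ∈ upper H ↔ (h : SL(2, E)) 1 0 = 0 := Iff.rfl

theorem diagChar_val (h : upper H) : (diagChar H h : E) = (h : SL(2, E)) 0 0 := rfl

theorem upper_det {h : SL(2, E)} (hh : h 1 0 = 0) : h 0 0 * h 1 1 = 1 := by
  have h1 := det_entries h
  rw [hh] at h1; linear_combination h1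

theorem eq_matU {h : SL(2, E)} (h10 : h 1 0 = 0) (h00 : h 0 0 = 1) : h = matU (h 0 1) := by
  have h1 := upper_det h10
  rw [h00, one_mul] at h1
  exact ext_entries (by rw [h00, matU_00]) (by rw [matU_01]) (by rw [h10, matU_10])
    (by rw [h1, matU_11])

theorem eq_neg_matU {h : SL(2, E)} (h10 : h 1 0 = 0) (h00 : h 0 0 = -1) :
    h = -matU (-h 0 1) := by
  have h1 := upper_det h10
  rw [h00] at h1
  have h11 : h 1 1 = -1 := by linear_combination -h1
  exact ext_entries (by rw [h00, neg_entry, matU_00]) (by rw [neg_entry, matU_01, neg_neg])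
    (by rw [h10, neg_entry, matU_10, neg_zero]) (by rw [h11, neg_entry, matU_11])

theorem Admissible.neg_mem (hH : Admissible H) {h : SL(2, E)} (hh : h ∈ H) : -h ∈ H := by
  have := mul_mem hH.neg_one_mem hh
  rwa [neg_one_mul] at this

theorem one_ne_neg_one (h2 : (2 : E) ≠ 0) : (1 : E) ≠ -1 := by
  intro h; apply h2; linear_combination h

theorem one_ne_neg_one' (h2 : (2 : E) ≠ 0) : (1 : SL(2, E)) ≠ -1 := by
  intro h
  have := congrArg (fun m : SL(2, E) => m 0 0) h
  simp only [neg_entry, one_00] at this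
  exact one_ne_neg_one h2 this

theorem Admissible.mem_center_iff (hH : Admissible H) {x : H} :
    x ∈ Subgroup.center H ↔ (x : SL(2, E)) = 1 ∨ (x : SL(2, E)) = -1 := by
  rw [Subgroup.mem_center_iff]
  constructor
  · intro hx
    obtain ⟨z, hz, hzH⟩ := hH.exists_matU
    obtain ⟨v, hv, hv10⟩ := hH.exists_lower
    have c1 : Commute (x : SL(2, E)) (matU z) := (congrArg Subtype.val (hx ⟨_, hzH⟩)).symm
    have c2 : Commute (x : SL(2, E)) v := (congrArg Subtype.val (hx ⟨_, hv⟩)).symm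
    by_contra! hne
    have c3 := commute_of_commute hne.1 hne.2 c1.symm c2.symm
    obtain ⟨e1, -, -⟩ := commute_entries c3
    simp only [matU_01, matU_10, mul_zero] at e1
    exact (mul_ne_zero hz hv10) e1
  · rintro (h | h) g <;> apply Subtype.ext <;> simp [h]

theorem Admissible.card_center (hH : Admissible H) : Nat.card (Subgroup.center H) = 2 := by
  have : (Subgroup.center H : Set H) = {1, ⟨-1, hH.neg_one_mem⟩} := by
    ext x
    simp only [SetLike.mem_coe, hH.mem_center_iff, Set.mem_insert_iff, Set.mem_singleton_iff,
      Subtype.ext_iff, Subgroup.coe_one]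
  change Nat.card ((Subgroup.center H : Set H) : Type _) = 2
  rw [this, Nat.card_coe_set_eq, Set.ncard_pair]
  intro h
  exact one_ne_neg_one' hH.two_ne_zero (congrArg Subtype.val h)

theorem Admissible.centralizersCommute (hH : Admissible H) : CentralizersCommute H := by
  intro x hx a b ha hb
  rw [hH.mem_center_iff] at hx
  push Not at hx
  have := commute_of_commute hx.1 hx.2 (congrArg Subtype.val ha) (congrArg Subtype.val hb)
  exact Subtype.ext this

/-- The normalizer of the centralizer of a noncentral semisimple element `x` moves `x` only to `x`
or `x⁻¹`. -/
theorem Admissible.card_normalizer_semisimple [Finite E] (hH : Admissible H) {x : H}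
    (hx : x ∉ Subgroup.center H) (ht : tr (x : SL(2, E)) ^ 2 ≠ 4) :
    Nat.card (Subgroup.normalizer (Subgroup.centralizer {x} : Set H))
        = Nat.card (Subgroup.centralizer {x}) ∨
      Nat.card (Subgroup.normalizer (Subgroup.centralizer {x} : Set H))
        = 2 * Nat.card (Subgroup.centralizer {x}) := by
  classical
  set C := Subgroup.centralizer {x} with hC
  set N := Subgroup.normalizer (C : Set H) with hN
  have hx' := hx
  rw [hH.mem_center_iff] at hx'
  push Not at hx'
  have hCN : C ≤ N := Subgroup.le_normalizer
  have hxC : x ∈ C := mem_centralizer_singleton_iff_commute.2 (Commute.refl x)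
  have hmove : ∀ n ∈ N, n * x * n⁻¹ = x ∨ n * x * n⁻¹ = x⁻¹ := by
    intro n hn
    have h1 : n * x * n⁻¹ ∈ C := (Subgroup.mem_normalizer_iff.1 hn x).1 hxC
    rw [hC, mem_centralizer_singleton_iff_commute] at h1
    have := eq_or_eq_inv_of_commute hx'.1 hx'.2 ht hH.two_ne_zero
      (congrArg Subtype.val h1) (tr_conj (n : SL(2, E)) x)
    rcases this with h | h
    · exact Or.inl (Subtype.ext h)
    · exact Or.inr (Subtype.ext h)
  have hfix : ∀ n : H, n * x * n⁻¹ = x → n ∈ C := by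
    intro n hn
    rw [hC, mem_centralizer_singleton_iff_commute]
    exact mul_inv_eq_iff_eq_mul.1 hn
  by_cases hle : ∃ n ∈ N, n ∉ C
  · right
    obtain ⟨n, hnN, hnC⟩ := hle
    have hn := (hmove n hnN).resolve_left fun h => hnC (hfix n h)
    have hunion : (N : Set H) = (C : Set H) ∪ (fun m => n * m) '' (C : Set H) := by
      ext m
      simp only [SetLike.mem_coe, Set.mem_union, Set.mem_image]
      constructor
      · intro hm
        rcases hmove m hm with h | h
        · exact Or.inl (hfix m h)
        · refine Or.inr ⟨n⁻¹ * m, hfix _ ?_, by group⟩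
          have : n⁻¹ * m * x * (n⁻¹ * m)⁻¹ = n⁻¹ * (m * x * m⁻¹) * n := by group
          rw [this, h, ← hn]; group
      · rintro (h | ⟨c, hc, rfl⟩)
        · exact hCN h
        · exact mul_mem hnN (hCN hc)
    have hdisj : Disjoint (C : Set H) ((fun m => n * m) '' (C : Set H)) := by
      rw [Set.disjoint_left]
      rintro m hm ⟨c, hc, rfl⟩
      apply hnC
      have := mul_mem hm (inv_mem hc)
      simpa using this
    have h1 : (N : Set H).ncard = (C : Set H).ncard + (C : Set H).ncard := by
      rw [hunion, Set.ncard_union_eq hdisj,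
        Set.ncard_image_of_injective _ (mul_right_injective n)]
    rw [two_mul]
    exact h1
  · left
    push Not at hle
    rw [le_antisymm hle hCN]

/-! ### The centralizer of a transvection -/

/-- A transvection fixing the point at infinity, as an element of `H`. -/
def unip {z : E} (hz : matU z ∈ H) : H := ⟨matU z, hz⟩

theorem mem_centralizer_unip_iff {z : E} (hz0 : z ≠ 0) (hz : matU z ∈ H) {h : H} :
    h ∈ Subgroup.centralizer {unip hz} ↔
      (h : SL(2, E)) 1 0 = 0 ∧ (h : SL(2, E)) 0 0 = (h : SL(2, E)) 1 1 := by
  rw [mem_centralizer_singleton_iff_commute]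
  constructor
  · intro hc
    have c1 : Commute (h : SL(2, E)) (matU z) := congrArg Subtype.val hc
    obtain ⟨e1, e2, e3⟩ := commute_entries c1
    simp only [matU_00, matU_01, matU_10, matU_11] at e1 e2 e3
    refine ⟨?_, ?_⟩
    · have : z * (h : SL(2, E)) 1 0 = 0 := by linear_combination -e1
      exact (mul_eq_zero.1 this).resolve_left hz0
    · apply mul_left_cancel₀ hz0; linear_combination e2
  · rintro ⟨h1, h2⟩
    apply Subtype.ext
    change (h : SL(2, E)) * matU z = matU z * h
    apply ext_entries <;>
      simp only [mul_entry, matU_00, matU_01, matU_10, matU_11, h1, h2] <;> ring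

theorem unip_notMem_center (hH : Admissible H) {z : E} (hz0 : z ≠ 0) (hz : matU z ∈ H) :
    unip hz ∉ Subgroup.center H := by
  rw [hH.mem_center_iff]
  rintro (h | h)
  · have := congrArg (fun m : SL(2, E) => m 0 1) h
    simp only [unip, matU_01, one_01] at this
    exact hz0 this
  · have := congrArg (fun m : SL(2, E) => m 0 1) h
    simp only [unip, matU_01, neg_entry, one_01, neg_zero] at this
    exact hz0 this

theorem Admissible.card_centralizer_unip [Finite E] (hH : Admissible H) {z : E} (hz0 : z ≠ 0)
    (hz : matU z ∈ H) :
    Nat.card (Subgroup.centralizer {unip hz}) = 2 * Nat.card (rootGroup H) := by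
  suffices h : Nat.card (Bool × rootGroup H) = Nat.card (Subgroup.centralizer {unip hz}) by
    rw [← h, Nat.card_prod]; simp
  let f : Bool × rootGroup H → Subgroup.centralizer {unip hz} := fun b =>
    if b.1 then ⟨⟨matU b.2, b.2.2⟩, by
      rw [mem_centralizer_unip_iff hz0]; exact ⟨matU_10 _, by simp [matU_00, matU_11]⟩⟩
    else ⟨⟨-matU (b.2 : E), hH.neg_mem b.2.2⟩, by
      rw [mem_centralizer_unip_iff hz0]
      exact ⟨by simp [matU_10], by simp [matU_00, matU_11]⟩⟩
  apply Nat.card_eq_of_bijective f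
  have ft : ∀ a, ((f (true, a) : H) : SL(2, E)) = matU (a : E) := fun a => rfl
  have ff : ∀ a, ((f (false, a) : H) : SL(2, E)) = -matU (a : E) := fun a => rfl
  have hne := one_ne_neg_one hH.two_ne_zero
  constructor
  · rintro ⟨b, a⟩ ⟨b', a'⟩ h
    have h' : ((f (b, a) : H) : SL(2, E)) = ((f (b', a') : H) : SL(2, E)) := by rw [h]
    have h00 := congrArg (fun m : SL(2, E) => m 0 0) h'
    have h01 := congrArg (fun m : SL(2, E) => m 0 1) h'
    cases b <;> cases b' <;>
      simp only [ft, ff, neg_entry, matU_00, matU_01, neg_inj] at h00 h01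
    · rw [Subtype.ext h01]
    · exact absurd h00.symm hne
    · exact absurd h00 hne
    · rw [Subtype.ext h01]
  · rintro ⟨h, hh⟩
    obtain ⟨h1, h3⟩ := (mem_centralizer_unip_iff hz0 hz).1 hh
    have hd := upper_det h1
    rw [← h3] at hd
    rcases mul_self_eq_one_iff.1 hd with h4 | h4
    · have h5 := eq_matU h1 h4
      refine ⟨(true, ⟨(h : SL(2, E)) 0 1, ?_⟩), ?_⟩
      · rw [mem_rootGroup, ← h5]; exact h.2
      · apply Subtype.ext; apply Subtype.ext
        rw [ft]; exact h5.symm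
    · have h5 := eq_neg_matU h1 h4
      refine ⟨(false, ⟨-(h : SL(2, E)) 0 1, ?_⟩), ?_⟩
      · rw [mem_rootGroup]
        have := hH.neg_mem h.2
        rw [h5, neg_neg] at this
        exact this
      · apply Subtype.ext; apply Subtype.ext
        rw [ff]; exact h5.symm

theorem normalizer_centralizer_unip {z : E} (hz0 : z ≠ 0) (hz : matU z ∈ H) :
    Subgroup.normalizer (Subgroup.centralizer {unip hz} : Set H) = upper H := by
  ext n
  rw [Subgroup.mem_normalizer_iff]
  constructor
  · intro hn
    have h1 := (hn (unip hz)).1 (mem_centralizer_singleton_iff_commute.2 (Commute.refl _))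
    have h2 := ((mem_centralizer_unip_iff hz0 hz).1 h1).1
    simp only [unip, Subgroup.coe_mul, Subgroup.coe_inv, mul_entry, inv_00, inv_10,
      matU_00, matU_01, matU_10, matU_11] at h2
    have h3 : z * ((n : SL(2, E)) 1 0 * (n : SL(2, E)) 1 0) = 0 := by linear_combination -h2
    rw [mem_upper]
    exact mul_self_eq_zero.1 ((mul_eq_zero.1 h3).resolve_left hz0)
  · intro hn m
    rw [mem_upper] at hn
    have hd := upper_det hn
    have hn0 : (n : SL(2, E)) 0 0 ≠ 0 := left_ne_zero_of_mul_eq_one hd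
    have hn1 : (n : SL(2, E)) 1 1 ≠ 0 := right_ne_zero_of_mul_eq_one hd
    rw [mem_centralizer_unip_iff hz0, mem_centralizer_unip_iff hz0]
    simp only [Subgroup.coe_mul, Subgroup.coe_inv, mul_entry, inv_00, inv_10, inv_11, inv_01, hn]
    generalize (n : SL(2, E)) 0 0 = t at *
    generalize (n : SL(2, E)) 1 1 = s at *
    constructor
    · rintro ⟨h1, h2⟩
      rw [h1, h2]
      constructor <;> ring
    · rintro ⟨h1, h2⟩
      have h3 : (m : SL(2, E)) 1 0 = 0 := by
        have : (s * s) * (m : SL(2, E)) 1 0 = 0 := by linear_combination h1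
        exact (mul_eq_zero.1 this).resolve_left (mul_ne_zero hn1 hn1)
      refine ⟨h3, ?_⟩
      rw [h3] at h2
      linear_combination h2 - ((m : SL(2, E)) 0 0 - (m : SL(2, E)) 1 1) * hd

end

end SLTwo

/-! ### The diagonal character and the torus -/

namespace SLTwo

section

variable {E : Type*} [Field E] {H : Subgroup SL(2, E)}

theorem card_ker_diagChar : Nat.card (diagChar H).ker = Nat.card (rootGroup H) := by
  let f : rootGroup H → (diagChar H).ker := fun a =>
    ⟨⟨⟨matU a, a.2⟩, matU_10 _⟩, by
      rw [MonoidHom.mem_ker]; ext; rw [diagChar_val]; exact matU_00 _⟩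
  symm
  apply Nat.card_eq_of_bijective f
  constructor
  · intro a b h
    have h' : matU (a : E) = matU (b : E) :=
      congrArg (fun k : (diagChar H).ker => ((k : upper H) : SL(2, E))) h
    have h01 := congrArg (fun m : SL(2, E) => m 0 1) h'
    simp only [matU_01] at h01
    exact Subtype.ext h01
  · rintro ⟨h, hh⟩
    have h00 : (h : SL(2, E)) 0 0 = 1 := by
      rw [← diagChar_val, MonoidHom.mem_ker.1 hh]; rfl
    have h5 := eq_matU h.2 h00
    refine ⟨⟨(h : SL(2, E)) 0 1, ?_⟩, ?_⟩
    · rw [mem_rootGroup, ← h5]; exact (h : H).2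
    · apply Subtype.ext; apply Subtype.ext; apply Subtype.ext
      exact h5.symm

theorem card_upper [Finite E] :
    Nat.card (upper H) = Nat.card (rootGroup H) * Nat.card (diagChar H).range := by
  rw [← card_ker_diagChar, Subgroup.card_eq_card_quotient_mul_card_subgroup (diagChar H).ker,
    mul_comm, Nat.card_congr (QuotientGroup.quotientKerEquivRange (diagChar H)).toEquiv]

theorem Admissible.neg_one_mem_range (hH : Admissible H) : (-1 : Eˣ) ∈ (diagChar H).range := by
  refine ⟨⟨⟨-1, hH.neg_one_mem⟩, ?_⟩, ?_⟩
  · rw [mem_upper]; simp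
  · ext; rw [diagChar_val]; simp

/-- Conjugation by an upper triangular matrix with diagonal `(t, t⁻¹)` multiplies the root group
by `t²`. -/
theorem sq_mul_mem_rootGroup {t : Eˣ} (ht : t ∈ (diagChar H).range) {a : E}
    (ha : a ∈ rootGroup H) : (t : E) ^ 2 * a ∈ rootGroup H := by
  obtain ⟨h, rfl⟩ := ht
  rw [diagChar_val, mem_rootGroup]
  have h10 : (h : SL(2, E)) 1 0 = 0 := h.2
  have hd := upper_det h10
  have : (h : SL(2, E)) * matU a * (h : SL(2, E))⁻¹ = matU ((h : SL(2, E)) 0 0 ^ 2 * a) := by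
    apply ext_entries <;>
      simp only [mul_entry, inv_00, inv_01, inv_10, inv_11, matU_00, matU_01, matU_10, matU_11, h10]
    · linear_combination hd
    · ring
    · ring
    · linear_combination hd
  rw [← this]
  exact mul_mem (mul_mem (h : H).2 ha) (inv_mem (h : H).2)

/-- The squares of the diagonal entries `t` act freely on the nonzero elements of the root group,
and `t ↦ t²` is at most two-to-one. -/
theorem Admissible.card_range_le [Finite E] (hH : Admissible H) :
    Nat.card (diagChar H).range + 2 ≤ 2 * Nat.card (rootGroup H) := by
  classical
  obtain ⟨z, hz0, hz⟩ := hH.exists_matU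
  have := Fintype.ofFinite E
  have := Fintype.ofFinite Eˣ
  let S : Finset Eˣ := ((diagChar H).range : Set Eˣ).toFinset
  let T : Finset E := ((rootGroup H : Set E).toFinset).erase 0
  have hS : S.card = Nat.card (diagChar H).range := by
    rw [Set.toFinset_card, ← Nat.card_eq_fintype_card]; rfl
  have hT : T.card + 1 = Nat.card (rootGroup H) := by
    rw [Finset.card_erase_add_one, Set.toFinset_card, ← Nat.card_eq_fintype_card]
    · rfl
    · simp [(rootGroup H).zero_mem]
  have h1 : S.card ≤ 2 * T.card := by
    apply Finset.card_le_mul_card_image_of_maps_to (f := fun t : Eˣ => (t : E) ^ 2 * z)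
    · intro t ht
      simp only [S, Set.mem_toFinset, SetLike.mem_coe] at ht
      simp only [T, Finset.mem_erase, Set.mem_toFinset, SetLike.mem_coe]
      exact ⟨mul_ne_zero (pow_ne_zero 2 t.ne_zero) hz0, sq_mul_mem_rootGroup ht hz⟩
    · intro b _
      by_cases hb : ∃ s ∈ S, (s : E) ^ 2 * z = b
      · obtain ⟨s, _, hs⟩ := hb
        have hsub : S.filter (fun t : Eˣ => (t : E) ^ 2 * z = b) ⊆ ({s, -s} : Finset Eˣ) := by
          intro t ht
          rw [Finset.mem_filter] at ht
          have h2 : (t : E) ^ 2 = (s : E) ^ 2 := mul_right_cancel₀ hz0 (ht.2.trans hs.symm)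
          rw [Finset.mem_insert, Finset.mem_singleton]
          rcases sq_eq_sq_iff_eq_or_eq_neg.1 h2 with h | h
          · exact Or.inl (Units.ext h)
          · exact Or.inr (Units.ext h)
        exact (Finset.card_le_card hsub).trans Finset.card_le_two
      · push Not at hb
        rw [Finset.filter_eq_empty_iff.2 fun t ht => hb t ht]
        simp
  omega

/-- If some diagonal entry is not `±1`, a matrix whose diagonal entry generates the group of all
diagonal entries is noncentral and semisimple, and restricting the diagonal character to its
centralizer gives an isomorphism onto that group. -/
theorem Admissible.exists_torus [Finite E] (hH : Admissible H)
    (h2 : Nat.card (diagChar H).range ≠ 2) :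
    ∃ x : H, x ∉ Subgroup.center H ∧ tr (x : SL(2, E)) ^ 2 ≠ 4 ∧
      Nat.card (Subgroup.centralizer {x}) = Nat.card (diagChar H).range := by
  obtain ⟨⟨t, ht⟩, hgen⟩ := IsCyclic.exists_generator (α := (diagChar H).range)
  obtain ⟨x, hx⟩ := ht
  have hx10 : (x : SL(2, E)) 1 0 = 0 := x.2
  have hxt : (x : SL(2, E)) 0 0 = t := by rw [← diagChar_val, hx]
  have hd := upper_det hx10
  -- otherwise the group of diagonal entries would be `{1, -1}`
  have hsq : (t : E) ^ 2 ≠ 1 := by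
    intro h
    apply h2
    have hone : (1 : Eˣ) ≠ -1 := fun h => one_ne_neg_one hH.two_ne_zero (congrArg Units.val h)
    have hset : ((diagChar H).range : Set Eˣ) = {1, -1} := by
      ext s
      simp only [SetLike.mem_coe, Set.mem_insert_iff, Set.mem_singleton_iff]
      constructor
      · intro hs
        obtain ⟨n, hn⟩ := Subgroup.mem_zpowers_iff.1 (hgen ⟨s, hs⟩)
        have hn' : t ^ n = s := congrArg Subtype.val hn
        have ht2 : t ^ 2 = 1 := Units.ext (by simpa using h)
        have hs2 : (s : E) ^ 2 = 1 := by
          have : s ^ 2 = 1 := by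
            rw [← hn', ← zpow_natCast, ← _root_.zpow_mul, mul_comm, _root_.zpow_mul, zpow_natCast,
              ht2, _root_.one_zpow]
          simpa using congrArg Units.val this
        rcases mul_self_eq_one_iff.1 ((sq (s : E)).symm.trans hs2) with h | h
        · exact Or.inl (Units.ext h)
        · exact Or.inr (Units.ext h)
      · rintro (rfl | rfl)
        · exact one_mem _
        · exact hH.neg_one_mem_range
    change Nat.card (((diagChar H).range : Set Eˣ) : Type _) = 2
    rw [hset, Nat.card_coe_set_eq, Set.ncard_pair hone]
  have hne : (x : SL(2, E)) 0 0 ≠ (x : SL(2, E)) 1 1 := by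
    intro h
    rw [← h, hxt] at hd
    exact hsq (by rw [sq]; exact hd)
  have htr : tr (x : SL(2, E)) ^ 2 ≠ 4 := by
    intro h
    apply hne
    rw [tr] at h
    have : ((x : SL(2, E)) 0 0 - (x : SL(2, E)) 1 1) ^ 2 = 0 := by linear_combination h - 4 * hd
    exact sub_eq_zero.1 (pow_eq_zero_iff _root_.two_ne_zero |>.1 this)
  have hxc : (x : H) ∉ Subgroup.center H := by
    rw [hH.mem_center_iff]
    rintro (h | h)
    · rw [h] at hne; simp at hne
    · rw [h] at hne; simp at hne
  have hxc' := hxc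
  rw [hH.mem_center_iff] at hxc'
  push Not at hxc'
  refine ⟨x, hxc, htr, ?_⟩
  have hup : ∀ c ∈ Subgroup.centralizer {(x : H)}, c ∈ upper H := by
    intro c hc
    rw [mem_centralizer_singleton_iff_commute] at hc
    obtain ⟨α, β, -, -, h3, -⟩ :=
      exists_combination_of_commute hxc'.1 hxc'.2 (congrArg Subtype.val hc)
    rw [mem_upper, h3, hx10, mul_zero]
  let f : Subgroup.centralizer {(x : H)} →* (diagChar H).range :=
    (diagChar H).rangeRestrict.comp (Subgroup.inclusion hup)
  apply Nat.card_eq_of_bijective f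
  constructor
  · rw [injective_iff_map_eq_one]
    intro c hc
    have h00 : ((c : H) : SL(2, E)) 0 0 = 1 :=
      congrArg (fun s : (diagChar H).range => ((s : Eˣ) : E)) hc
    have h10 : ((c : H) : SL(2, E)) 1 0 = 0 := hup c c.2
    have h1 := eq_matU h10 h00
    have hcx := mem_centralizer_singleton_iff_commute.1 c.2
    obtain ⟨-, e2, -⟩ := commute_entries (congrArg Subtype.val hcx :
      Commute ((c : H) : SL(2, E)) (x : SL(2, E)))
    have h11 : ((c : H) : SL(2, E)) 1 1 = 1 := by rw [h1, matU_11]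
    rw [h00, h11] at e2
    have : ((x : SL(2, E)) 0 0 - (x : SL(2, E)) 1 1) * ((c : H) : SL(2, E)) 0 1 = 0 := by
      linear_combination -e2
    have h01 := (mul_eq_zero.1 this).resolve_left (sub_ne_zero.2 hne)
    apply Subtype.ext; apply Subtype.ext
    rw [h1, h01, matU_zero]; rfl
  · rintro s
    obtain ⟨n, hn⟩ := Subgroup.mem_zpowers_iff.1 (hgen s)
    refine ⟨⟨(x : H), mem_centralizer_singleton_iff_commute.2 (Commute.refl _)⟩ ^ n, ?_⟩
    rw [map_zpow, ← hn]
    congr 1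
    exact Subtype.ext hx

end

end SLTwo

/-! ### The orbit of the point at infinity -/

namespace SLTwo

section

open Classical in
/-- The action of `SL₂(E)` on the projective line by Möbius transformations. -/
noncomputable instance projectiveAction {E : Type*} [Field E] : MulAction SL(2, E) (OnePoint E) :=
  MulAction.compHom _ (Matrix.SpecialLinearGroup.toGL (n := Fin 2) (R := E))

/-- The finite points of the `H`-orbit of the point at infinity. -/
def finiteOrbit {E : Type*} [Field E] (H : Subgroup SL(2, E)) : Set E :=
  {x | (x : OnePoint E) ∈ MulAction.orbit H (OnePoint.infty : OnePoint E)}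

variable {E : Type*} [Field E] {H : Subgroup SL(2, E)}

open Classical in
theorem smul_infty (g : SL(2, E)) :
    g • (OnePoint.infty : OnePoint E) =
      if g 1 0 = 0 then OnePoint.infty else ((g 0 0 / g 1 0 : E) : OnePoint E) :=
  OnePoint.smul_infty_eq_ite (Matrix.SpecialLinearGroup.toGL g)

open Classical in
theorem smul_coe (g : SL(2, E)) (k : E) :
    g • (k : OnePoint E) = if g 1 0 * k + g 1 1 = 0 then OnePoint.infty
      else (((g 0 0 * k + g 0 1) / (g 1 0 * k + g 1 1) : E) : OnePoint E) :=
  OnePoint.smul_some_eq_ite (g := Matrix.SpecialLinearGroup.toGL g)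

theorem smul_infty_eq_iff (g : SL(2, E)) :
    g • (OnePoint.infty : OnePoint E) = OnePoint.infty ↔ g 1 0 = 0 := by
  rw [smul_infty]
  split_ifs with h <;> simp [h]

theorem stabilizer_infty : MulAction.stabilizer H (OnePoint.infty : OnePoint E) = upper H := by
  ext h
  rw [MulAction.mem_stabilizer_iff, mem_upper, Subgroup.smul_def, smul_infty_eq_iff]

theorem matU_smul (a x : E) : matU a • (x : OnePoint E) = ((x + a : E) : OnePoint E) := by
  rw [smul_coe]
  simp [matU_00, matU_01, matU_10, matU_11]

theorem mem_finiteOrbit {x : E} : x ∈ finiteOrbit H ↔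
    (x : OnePoint E) ∈ MulAction.orbit H (OnePoint.infty : OnePoint E) := Iff.rfl

theorem smul_mem_orbit {g : SL(2, E)} (hg : g ∈ H) {ω : OnePoint E}
    (hω : ω ∈ MulAction.orbit H (OnePoint.infty : OnePoint E)) :
    g • ω ∈ MulAction.orbit H (OnePoint.infty : OnePoint E) := by
  obtain ⟨h, rfl⟩ := hω
  exact ⟨⟨g, hg⟩ * h, mul_smul (⟨g, hg⟩ : H) h _⟩

theorem add_mem_finiteOrbit {x a : E} (hx : x ∈ finiteOrbit H) (ha : a ∈ rootGroup H) :
    x + a ∈ finiteOrbit H := by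
  rw [mem_finiteOrbit, ← matU_smul]
  exact smul_mem_orbit ha hx

theorem card_orbit [Finite E] : Nat.card (MulAction.orbit H (OnePoint.infty : OnePoint E))
    = Nat.card (finiteOrbit H) + 1 := by
  have h : (MulAction.orbit H (OnePoint.infty : OnePoint E))
      = insert OnePoint.infty ((fun x : E => (x : OnePoint E)) '' finiteOrbit H) := by
    ext ω
    induction ω using OnePoint.rec with
    | infty => simp [MulAction.mem_orbit_self]
    | coe x => simp [mem_finiteOrbit]
  rw [h, Nat.card_coe_set_eq, Nat.card_coe_set_eq, Set.ncard_insert_of_notMem,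
    Set.ncard_image_of_injective _ OnePoint.coe_injective]
  simp

theorem card_eq_card_upper_mul [Finite E] :
    Nat.card H = Nat.card (upper H) * (Nat.card (finiteOrbit H) + 1) := by
  rw [← card_orbit, ← stabilizer_infty, mul_comm, ← Nat.card_prod]
  exact Nat.card_congr (MulAction.orbitProdStabilizerEquivGroup H _).symm

/-- The root group acts freely on the finite points of the orbit by translations. -/
theorem card_rootGroup_dvd : Nat.card (rootGroup H) ∣ Nat.card (finiteOrbit H) := by
  have h : finiteOrbit H = QuotientAddGroup.mk ⁻¹'
      ((QuotientAddGroup.mk : E → E ⧸ rootGroup H) '' finiteOrbit H) := by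
    ext x
    constructor
    · intro hx; exact ⟨x, hx, rfl⟩
    · rintro ⟨y, hy, hxy⟩
      have := add_mem_finiteOrbit hy (QuotientAddGroup.eq.1 hxy)
      simpa using this
  rw [h, Nat.card_congr (QuotientAddGroup.preimageMkEquivAddSubgroupProdSet _ _), Nat.card_prod]
  exact dvd_mul_right _ _

theorem Admissible.finiteOrbit_nonempty (hH : Admissible H) : (finiteOrbit H).Nonempty := by
  obtain ⟨v, hv, hv10⟩ := hH.exists_lower
  refine ⟨v 0 0 / v 1 0, ?_⟩
  have := smul_mem_orbit hv (MulAction.mem_orbit_self (M := H) (OnePoint.infty : OnePoint E))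
  rwa [smul_infty, if_neg hv10] at this

/-- `|H| = |B| (1 + f q)` with `B` the upper triangular subgroup, `q` the order of the root group
and `f` positive. -/
theorem Admissible.exists_card_finiteOrbit [Finite E] (hH : Admissible H) :
    ∃ f : ℕ, 0 < f ∧ Nat.card (finiteOrbit H) = Nat.card (rootGroup H) * f := by
  obtain ⟨f, hf⟩ := card_rootGroup_dvd (H := H)
  refine ⟨f, Nat.pos_of_ne_zero ?_, hf⟩
  rintro rfl
  have : Nonempty (finiteOrbit H) := hH.finiteOrbit_nonempty.to_subtype
  have := Nat.card_pos (α := finiteOrbit H)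
  omega

/-- A `p`-element of `H` fixes a point of the orbit of infinity, because the cardinality of this
orbit is congruent to `1` modulo `p`. -/
theorem Admissible.exists_fixed_of_pow_char [Finite E] {p : ℕ} [Fact p.Prime] [CharP E p]
    (hH : Admissible H) {y : H} (hy : y ^ p = 1) :
    ∃ h : H, h⁻¹ • y • h • (OnePoint.infty : OnePoint E) = OnePoint.infty := by
  have hdvd : p ∣ Nat.card (rootGroup H) := by
    obtain ⟨z, hz0, hz⟩ := hH.exists_matU
    have h1 : addOrderOf (⟨z, hz⟩ : rootGroup H) ∣ Nat.card (rootGroup H) :=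
      addOrderOf_dvd_natCard _
    have h2 : addOrderOf (⟨z, hz⟩ : rootGroup H) = p := by
      apply addOrderOf_eq_prime
      · apply Subtype.ext; simp
      · intro h; exact hz0 (congrArg Subtype.val h)
    rwa [h2] at h1
  have hP : IsPGroup p (Subgroup.zpowers y) := by
    rintro ⟨g, hg⟩
    obtain ⟨n, rfl⟩ := Subgroup.mem_zpowers_iff.1 hg
    refine ⟨1, Subtype.ext ?_⟩
    rw [pow_one, Subgroup.coe_pow, Subgroup.coe_one, ← zpow_natCast, ← _root_.zpow_mul, mul_comm,
      _root_.zpow_mul, zpow_natCast, hy, _root_.one_zpow]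
  have hnd : ¬ p ∣ Nat.card (MulAction.orbit H (OnePoint.infty : OnePoint E)) := by
    rw [card_orbit]
    intro h
    have h1 := (Nat.dvd_add_right (hdvd.trans (card_rootGroup_dvd (H := H)))).1 h
    exact (Fact.out : p.Prime).one_lt.ne' (Nat.dvd_one.1 h1)
  obtain ⟨⟨ω, h, hω⟩, hfix⟩ := hP.nonempty_fixed_point_of_prime_not_dvd_card
    (MulAction.orbit H (OnePoint.infty : OnePoint E)) hnd
  refine ⟨h, ?_⟩
  have h1 := congrArg Subtype.val (hfix ⟨y, Subgroup.mem_zpowers y⟩)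
  change y • ω = ω at h1
  change h • OnePoint.infty = ω at hω
  rw [hω, h1, ← hω, inv_smul_smul]

/-- Every noncentral element of trace `±2` is conjugate into the centralizer of a given
transvection. -/
theorem Admissible.mem_cell_unip [Finite E] {p : ℕ} [Fact p.Prime] [CharP E p]
    (hH : Admissible H) {z : E} (hz0 : z ≠ 0) (hz : matU z ∈ H) {y : H}
    (hy : y ∉ Subgroup.center H) (ht : tr (y : SL(2, E)) ^ 2 = 4) :
    y ∈ centralizerCell (unip hz) := by
  have key : ∀ w : H, tr (w : SL(2, E)) = 2 →
      ∃ h : H, h * w * h⁻¹ ∈ Subgroup.centralizer {unip hz} := by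
    intro w hw
    obtain ⟨h, hh⟩ := hH.exists_fixed_of_pow_char (p := p) (y := w)
      (Subtype.ext (pow_char_eq_one hw))
    refine ⟨h⁻¹, ?_⟩
    rw [inv_inv, mem_centralizer_unip_iff hz0]
    have h10 : ((h⁻¹ * w * h : H) : SL(2, E)) 1 0 = 0 := by
      rw [← mem_upper, ← stabilizer_infty, MulAction.mem_stabilizer_iff, mul_smul, mul_smul]
      exact hh
    refine ⟨h10, ?_⟩
    have h1 := upper_det h10
    have h2 : tr ((h⁻¹ * w * h : H) : SL(2, E)) = 2 := by
      rw [← hw, ← tr_conj ((h⁻¹ : H) : SL(2, E)) (w : SL(2, E))]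
      simp
    rw [tr] at h2
    have : (((h⁻¹ * w * h : H) : SL(2, E)) 0 0 - ((h⁻¹ * w * h : H) : SL(2, E)) 1 1) ^ 2 = 0 := by
      linear_combination (((h⁻¹ * w * h : H) : SL(2, E)) 0 0
        + ((h⁻¹ * w * h : H) : SL(2, E)) 1 1 + 2) * h2 - 4 * h1
    exact sub_eq_zero.1 (pow_eq_zero_iff _root_.two_ne_zero |>.1 this)
  refine ⟨hy, ?_⟩
  have h4 : (tr (y : SL(2, E)) - 2) * (tr (y : SL(2, E)) + 2) = 0 := by linear_combination ht
  rcases mul_eq_zero.1 h4 with h | h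
  · exact key y (sub_eq_zero.1 h)
  · obtain ⟨k, hk⟩ := key ⟨-y, hH.neg_mem y.2⟩ (by
      rw [tr_neg]; linear_combination -h)
    refine ⟨k, ?_⟩
    rw [mem_centralizer_unip_iff hz0] at hk ⊢
    simpa using hk

end

end SLTwo

/-! ### The class equation -/

namespace SLTwo

section

/-- The proportion of the elements of a finite group that lie in the cell of `x`. -/
noncomputable def weight {G : Type*} [Group G] (x : G) : ℚ :=
  (Nat.card (centralizerCell x) : ℚ) / Nat.card G

variable {E : Type*} [Field E] {H : Subgroup SL(2, E)}

theorem tr_sq_of_mem_cell_unip {z : E} (hz0 : z ≠ 0) (hz : matU z ∈ H) {y : H}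
    (hy : y ∈ centralizerCell (unip hz)) : tr (y : SL(2, E)) ^ 2 = 4 := by
  obtain ⟨-, h, hh⟩ := hy
  rw [mem_centralizer_unip_iff hz0] at hh
  obtain ⟨h10, h00⟩ := hh
  have h1 := upper_det h10
  have h2 : tr ((h * y * h⁻¹ : H) : SL(2, E)) = tr (y : SL(2, E)) := by
    rw [← tr_conj (h : SL(2, E)) (y : SL(2, E))]; simp
  rw [← h2, tr, ← h00]
  rw [← h00] at h1
  linear_combination 4 * h1

variable [Finite E]

theorem Admissible.weight_mul (hH : Admissible H) {x : H} (hx : x ∉ Subgroup.center H) :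
    weight x * Nat.card (Subgroup.normalizer (Subgroup.centralizer {x} : Set H))
      = Nat.card (Subgroup.centralizer {x}) - 2 := by
  have h1 := hH.centralizersCommute.card_centralizerCell_mul hx
  rw [hH.card_center] at h1
  have h0 : (Nat.card H : ℚ) ≠ 0 := by exact_mod_cast Nat.card_pos.ne'
  have h2 : (Nat.card (centralizerCell x) : ℚ)
      * Nat.card (Subgroup.normalizer (Subgroup.centralizer {x} : Set H)) + Nat.card H * 2
      = Nat.card H * Nat.card (Subgroup.centralizer {x}) := by exact_mod_cast h1
  rw [weight]
  field_simp
  linear_combination h2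

theorem Admissible.sum_weight_le (hH : Admissible H)
    (S : Finset H) (hS : ∀ x ∈ S, x ∉ Subgroup.center H)
    (hd : ∀ x ∈ S, ∀ y ∈ S, x ≠ y → y ∉ centralizerCell x) :
    ∑ x ∈ S, weight x + 2 / Nat.card H ≤ 1 := by
  have h1 := hH.centralizersCommute.sum_card_centralizerCell_le S hS hd
  rw [hH.card_center] at h1
  have h0 : (0 : ℚ) < Nat.card H := by exact_mod_cast Nat.card_pos
  simp only [weight]
  rw [← Finset.sum_div, ← add_div, div_le_one h0]
  exact_mod_cast h1

theorem Admissible.one_le_sum_weight (hH : Admissible H) (S : Finset H)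
    (hS : ∀ y, y ∉ Subgroup.center H → ∃ x ∈ S, y ∈ centralizerCell x) :
    1 ≤ ∑ x ∈ S, weight x + 2 / Nat.card H := by
  have h1 := card_le_sum_card_centralizerCell S hS
  rw [hH.card_center] at h1
  have h0 : (0 : ℚ) < Nat.card H := by exact_mod_cast Nat.card_pos
  simp only [weight]
  rw [← Finset.sum_div, ← add_div, one_le_div h0]
  exact_mod_cast h1

/-- The cell of a semisimple element with centralizer of order `2e` contains the proportion
`(e - 1) / e` or `(e - 1) / 2e` of the group. -/
theorem Admissible.weight_semisimple (hH : Admissible H) {x : H}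
    (hx : x ∉ Subgroup.center H) (ht : tr (x : SL(2, E)) ^ 2 ≠ 4) :
    ∃ e : ℕ, 2 ≤ e ∧ Nat.card (Subgroup.centralizer {x}) = 2 * e ∧
      (weight x = (e - 1) / e ∨ weight x = (e - 1) / (2 * e)) := by
  have hle : Subgroup.center H ≤ Subgroup.centralizer {x} := Subgroup.center_le_centralizer _
  obtain ⟨e, he⟩ := Subgroup.card_dvd_of_le hle
  rw [hH.card_center] at he
  have hlt : Nat.card (Subgroup.center H) < Nat.card (Subgroup.centralizer {x}) := by
    apply Set.ncard_lt_ncard (s := (Subgroup.center H : Set H))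
    refine ⟨hle, fun h => hx (h ?_)⟩
    exact mem_centralizer_singleton_iff_commute.2 (Commute.refl x)
  rw [hH.card_center, he] at hlt
  have he2 : 2 ≤ e := by omega
  refine ⟨e, he2, he, ?_⟩
  have he0 : (e : ℚ) ≠ 0 := by exact_mod_cast (by omega : e ≠ 0)
  have h1 := hH.weight_mul hx
  rcases hH.card_normalizer_semisimple hx ht with h | h
  · left
    rw [h, he] at h1
    push_cast at h1
    rw [eq_div_iff he0]; linarith
  · right
    rw [h, he] at h1
    push_cast at h1
    rw [eq_div_iff (by simpa using he0)]; linarith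

theorem Admissible.weight_unip (hH : Admissible H) {z : E} (hz0 : z ≠ 0) (hz : matU z ∈ H) :
    weight (unip hz) * (Nat.card (rootGroup H) * Nat.card (diagChar H).range)
      = 2 * Nat.card (rootGroup H) - 2 := by
  have h1 := hH.weight_mul (unip_notMem_center hH hz0 hz)
  rw [normalizer_centralizer_unip hz0, card_upper, hH.card_centralizer_unip hz0 hz] at h1
  push_cast at h1
  exact h1

theorem Admissible.exists_card_range (hH : Admissible H) :
    ∃ d : ℕ, 0 < d ∧ Nat.card (diagChar H).range = 2 * d := by
  have h1 : orderOf (⟨-1, hH.neg_one_mem_range⟩ : (diagChar H).range) ∣ _ := orderOf_dvd_natCard _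
  rw [orderOf_eq_prime (p := 2)] at h1
  · obtain ⟨d, hd⟩ := h1
    refine ⟨d, Nat.pos_of_ne_zero ?_, hd⟩
    rintro rfl
    exact Nat.card_pos.ne' hd
  · apply Subtype.ext; simp
  · intro h
    exact one_ne_neg_one hH.two_ne_zero
      (congrArg (fun s : (diagChar H).range => ((s : Eˣ) : E)) h).symm

/-- The divisibility argument that solves the class equation with three cells. -/
theorem class_equation_arith {q d e f : ℕ} (hq : 3 ≤ q) (hf : 0 < f) (hdq : d + 1 ≤ q) (hd : 0 < d)
    (h : d * (1 + q * f) = e * (1 + (q - 2) * f)) :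
    f = 1 ∨ (q = 3 ∧ f = 3 ∧ d = 2 ∧ e = 5) := by
  obtain ⟨k, rfl⟩ : ∃ k, q = k + 2 := ⟨q - 2, by omega⟩
  rw [Nat.add_sub_cancel] at h
  have hcop : Nat.Coprime (1 + k * f) f := by
    simp
  have hdvd : (1 + k * f) ∣ f * (2 * d) := by
    have h1 : (1 + k * f) ∣ d * (1 + (k + 2) * f) := ⟨e, by rw [h]; ring⟩
    have h2 : d * (1 + (k + 2) * f) = d * (1 + k * f) + f * (2 * d) := by ring
    rw [h2] at h1
    exact (Nat.dvd_add_right (Dvd.intro_left d rfl)).1 h1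
  have hm : (1 + k * f) ∣ 2 * d := hcop.dvd_of_dvd_mul_left hdvd
  have hle := Nat.le_of_dvd (by omega) hm
  rcases Nat.lt_or_ge f 4 with hf4 | hf4
  · interval_cases f
    · exact Or.inl rfl
    · exfalso
      have hodd : Nat.Coprime (1 + k * 2) 2 := by simp
      have := Nat.le_of_dvd (by omega) (hodd.dvd_of_dvd_mul_left hm)
      omega
    · right
      have : k = 1 := by omega
      subst this
      omega
  · exfalso
    have : k * 4 ≤ k * f := Nat.mul_le_mul_left k hf4
    omega

end

end SLTwo

namespace SLTwo

section

variable {E : Type*} [Field E] {H : Subgroup SL(2, E)} [Finite E]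

/-- The class equation shows that the orbit of infinity has `q + 1` points, where `q` is the order
of the root group, except for one configuration: there `q = 3`, the orbit has `10` points, and every
noncentral element of trace not `±2` is conjugate into one of two centralizers, of orders `4` and `10`. -/
theorem Admissible.card_finiteOrbit_or_exceptional {p : ℕ} [Fact p.Prime] [CharP E p]
    (hp : 3 ≤ p) (hH : Admissible H) :
    Nat.card (finiteOrbit H) = Nat.card (rootGroup H) ∨
      (Nat.card (rootGroup H) = 3 ∧ Nat.card (finiteOrbit H) = 9 ∧ ∃ t y : H,
        Nat.card (Subgroup.centralizer {t}) = 4 ∧ Nat.card (Subgroup.centralizer {y}) = 10 ∧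
        ∀ w : H, w ∉ Subgroup.center H → tr (w : SL(2, E)) ^ 2 ≠ 4 →
          w ∈ centralizerCell t ∨ w ∈ centralizerCell y) := by
  classical
  obtain ⟨z, hz0, hz⟩ := hH.exists_matU
  obtain ⟨f, hf, hcf⟩ := hH.exists_card_finiteOrbit
  obtain ⟨d, hd, hcd⟩ := hH.exists_card_range
  have hdq := hH.card_range_le
  have hwu := hH.weight_unip hz0 hz
  have hcH := card_eq_card_upper_mul (H := H)
  rw [card_upper] at hcH
  have huc := unip_notMem_center hH hz0 hz
  have hcell : ∀ y : H, y ∉ Subgroup.center H → y ∉ centralizerCell (unip hz) →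
      tr (y : SL(2, E)) ^ 2 ≠ 4 := fun y hy hyu ht => hyu (hH.mem_cell_unip (p := p) hz0 hz hy ht)
  set q := Nat.card (rootGroup H) with hq
  have hq3 : 3 ≤ q := by
    have h1 : addOrderOf (⟨z, hz⟩ : rootGroup H) ∣ q := addOrderOf_dvd_natCard _
    rw [addOrderOf_eq_prime (p := p) (by apply Subtype.ext; simp)
      (fun h => hz0 (congrArg Subtype.val h))] at h1
    exact hp.trans (Nat.le_of_dvd Nat.card_pos h1)
  rw [hcd] at hdq hcH hwu
  rw [hcf] at hcH
  have hdq' : d + 1 ≤ q := by omega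
  suffices hmain : f = 1 ∨ (q = 3 ∧ f = 3 ∧ d = 2 ∧ ∃ t y : H,
        Nat.card (Subgroup.centralizer {t}) = 4 ∧ Nat.card (Subgroup.centralizer {y}) = 10 ∧
        ∀ w : H, w ∉ Subgroup.center H → tr (w : SL(2, E)) ^ 2 ≠ 4 →
          w ∈ centralizerCell t ∨ w ∈ centralizerCell y) by
    rcases hmain with rfl | ⟨h1, rfl, rfl, h2⟩
    · left; rw [hcf, mul_one]
    · right
      refine ⟨h1, ?_, h2⟩
      rw [hcf, h1]
  have hq0 : (0 : ℚ) < q := by exact_mod_cast (by omega : 0 < q)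
  have hd0 : (0 : ℚ) < d := by exact_mod_cast hd
  have hf0 : (0 : ℚ) < f := by exact_mod_cast hf
  have hqf : (0 : ℚ) < 1 + q * f := by positivity
  have hN : (2 : ℚ) / Nat.card H = 1 / (q * d * (1 + q * f)) := by
    rw [hcH]; push_cast; field_simp; ring
  have hWu : weight (unip hz) = (q - 1) / (q * d) := by
    rw [eq_div_iff (by positivity)]
    push_cast at hwu
    linarith
  have hq3' : (3 : ℚ) ≤ q := by exact_mod_cast hq3
  have hf1 : (1 : ℚ) ≤ f := by exact_mod_cast hf
  have hquarter : ∀ y : H, y ∉ Subgroup.center H → tr (y : SL(2, E)) ^ 2 ≠ 4 →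
      1 / 4 ≤ weight y := by
    intro y hy ht
    obtain ⟨e, he, -, h | h⟩ := hH.weight_semisimple hy ht
    all_goals
      have he' : (2 : ℚ) ≤ e := by exact_mod_cast he
      rw [h, le_div_iff₀ (by positivity)]
      linarith
  rcases Nat.lt_or_ge d 2 with hd2 | hd2
  · -- The diagonal entries are `±1`. The proportion `f / (1 + q f)`, less than `1 / q`, is left for
    -- the semisimple cells, each of which takes at least `1 / 4`: so `q = 3`, and there is one cell.
    have hd1 : d = 1 := by omega
    subst hd1
    left
    have hex : ∃ y : H, y ∉ Subgroup.center H ∧ y ∉ centralizerCell (unip hz) := by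
      by_contra! hno
      have h1 := hH.one_le_sum_weight {unip hz} fun y hy =>
        ⟨_, Finset.mem_singleton_self _, hno y hy⟩
      rw [Finset.sum_singleton, hN, hWu, div_add_div _ _ (by positivity) (by positivity),
        one_le_div (by positivity)] at h1
      push_cast at h1
      nlinarith [mul_pos hq0 hf0, mul_pos (mul_pos hq0 hq0) hf0]
    obtain ⟨y, hyc, hyu⟩ := hex
    have hyt := hcell y hyc hyu
    have hne : unip hz ≠ y := fun h => hyu (h ▸ self_mem_centralizerCell huc)
    have huy : unip hz ∉ centralizerCell y := fun h => hyu (mem_centralizerCell_symm hyc h)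
    have hle := hH.sum_weight_le {unip hz, y} (by simp [huc, hyc]) (by
      intro a ha b hb hab
      simp only [Finset.mem_insert, Finset.mem_singleton] at ha hb
      rcases ha with rfl | rfl <;> rcases hb with rfl | rfl <;>
        first | assumption | exact absurd rfl hab)
    rw [Finset.sum_pair hne, hN, hWu] at hle
    have hrest : weight y ≤ f / (1 + q * f) := by
      have : (f : ℚ) / (1 + q * f)
          = 1 - (q - 1) / (q * (1 : ℕ)) - 1 / (q * (1 : ℕ) * (1 + q * f)) := by
        push_cast; field_simp; ring
      rw [this]; linarith
    have hq4 : q = 3 := by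
      have h1 := (hquarter y hyc hyt).trans hrest
      rw [div_le_div_iff₀ (by norm_num) hqf] at h1
      have h2 : (q : ℚ) * f < 4 * f := by linarith
      have h3 : (q : ℚ) < 4 := lt_of_mul_lt_mul_right h2 hf0.le
      have h4 : q < 4 := by exact_mod_cast h3
      omega
    rw [hq4] at hrest hWu hN hle hqf
    push_cast at hrest hWu hN hle hqf
    have hlt : weight y < 1 / 3 := by
      refine hrest.trans_lt ?_
      rw [div_lt_div_iff₀ hqf (by norm_num)]
      linarith
    have hwy : weight y = 1 / 4 := by
      obtain ⟨e, he, -, h | h⟩ := hH.weight_semisimple hyc hyt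
      · have he' : (2 : ℚ) ≤ e := by exact_mod_cast he
        rw [h, div_lt_iff₀ (by positivity)] at hlt
        linarith
      · have he' : (2 : ℚ) ≤ e := by exact_mod_cast he
        rw [h, div_lt_iff₀ (by positivity)] at hlt
        have h3 : (e : ℚ) < 3 := by linarith
        have h4 : e < 3 := by exact_mod_cast h3
        have h5 : e = 2 := by omega
        rw [h, h5]; norm_num
    have hall : ∀ w : H, w ∉ Subgroup.center H → ∃ x ∈ ({unip hz, y} : Finset H),
        w ∈ centralizerCell x := by
      by_contra! hno
      obtain ⟨w, hwc, hw⟩ := hno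
      have hwu' := hw (unip hz) (by simp)
      have hwy' := hw y (by simp)
      have huw : unip hz ∉ centralizerCell w := fun h => hwu' (mem_centralizerCell_symm hwc h)
      have hyw : y ∉ centralizerCell w := fun h => hwy' (mem_centralizerCell_symm hwc h)
      have hne1 : unip hz ≠ w := fun h => hwu' (h ▸ self_mem_centralizerCell huc)
      have hne2 : y ≠ w := fun h => hwy' (h ▸ self_mem_centralizerCell hyc)
      have h1 := hH.sum_weight_le {unip hz, y, w} (by simp [huc, hyc, hwc]) (by
        intro a ha b hb hab
        simp only [Finset.mem_insert, Finset.mem_singleton] at ha hb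
        rcases ha with rfl | rfl | rfl <;> rcases hb with rfl | rfl | rfl <;>
          first | assumption | exact absurd rfl hab)
      rw [Finset.sum_insert (by simp [hne, hne1]), Finset.sum_pair hne2, hN, hWu, hwy] at h1
      have h2 := hquarter w hwc (hcell w hwc hwu')
      have h3 : (0 : ℚ) < 1 / (3 * 1 * (1 + 3 * f)) := by positivity
      have h4 : (f : ℚ) / (1 + 3 * f) < 1 / 3 := by
        rw [div_lt_div_iff₀ hqf (by norm_num)]; linarith
      linarith
    have h1 := hH.one_le_sum_weight _ hall
    rw [Finset.sum_pair hne, hN, hWu, hwy] at h1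
    have h2 : (1 : ℚ) / 12 ≤ 1 / (3 * 1 * (1 + 3 * f)) := by linarith
    rw [div_le_div_iff₀ (by norm_num) (by positivity)] at h2
    have h3 : (f : ℚ) ≤ 1 := by linarith
    have h4 : f ≤ 1 := by exact_mod_cast h3
    omega
  · have hd2' : (2 : ℚ) ≤ d := by exact_mod_cast hd2
    obtain ⟨t, htc, htt, htcard⟩ := hH.exists_torus (by rw [hcd]; omega)
    rw [hcd] at htcard
    have hut : t ∉ centralizerCell (unip hz) := fun h => htt (tr_sq_of_mem_cell_unip hz0 hz h)
    have htu : unip hz ∉ centralizerCell t := fun h => hut (mem_centralizerCell_symm htc h)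
    have hne : unip hz ≠ t := fun h => hut (h ▸ self_mem_centralizerCell huc)
    have hsum3 : ∀ y : H, y ∉ Subgroup.center H → y ∉ centralizerCell (unip hz) →
        y ∉ centralizerCell t →
        (q - 1) / (q * d) + (weight t + weight y) + 1 / (q * d * (1 + q * f)) ≤ (1 : ℚ) := by
      intro y hyc hyu hyt
      have huy : unip hz ∉ centralizerCell y := fun h => hyu (mem_centralizerCell_symm hyc h)
      have hty : t ∉ centralizerCell y := fun h => hyt (mem_centralizerCell_symm hyc h)
      have hne1 : unip hz ≠ y := fun h => hyu (h ▸ self_mem_centralizerCell huc)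
      have hne2 : t ≠ y := fun h => hyt (h ▸ self_mem_centralizerCell htc)
      have h1 := hH.sum_weight_le {unip hz, t, y} (by simp [huc, hyc, htc]) (by
        intro a ha b hb hab
        simp only [Finset.mem_insert, Finset.mem_singleton] at ha hb
        rcases ha with rfl | rfl | rfl <;> rcases hb with rfl | rfl | rfl <;>
          first | assumption | exact absurd rfl hab)
      rwa [Finset.sum_insert (by simp [hne, hne1]), Finset.sum_pair hne2, hN, hWu] at h1
    have hcov2 : (∀ y : H, y ∉ Subgroup.center H → y ∉ centralizerCell (unip hz) →
        y ∈ centralizerCell t) →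
        (1 : ℚ) ≤ (q - 1) / (q * d) + weight t + 1 / (q * d * (1 + q * f)) := by
      intro hall
      have h1 := hH.one_le_sum_weight {unip hz, t} fun w hwc => by
        by_cases hwu' : w ∈ centralizerCell (unip hz)
        · exact ⟨_, by simp, hwu'⟩
        · exact ⟨t, by simp, hall w hwc hwu'⟩
      rwa [Finset.sum_pair hne, hN, hWu] at h1
    have hWt : weight t = (d - 1) / d ∨ weight t = (d - 1) / (2 * d) := by
      obtain ⟨e, -, he, h⟩ := hH.weight_semisimple htc htt
      have : d = e := by omega
      rwa [this]
    have hsmall : (1 : ℚ) / (q * d * (1 + q * f)) ≤ 1 / (4 * (q * d)) := by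
      apply one_div_le_one_div_of_le (by positivity)
      have h1 : (4 : ℚ) ≤ 1 + q * f := by nlinarith
      have h2 : (0 : ℚ) < q * d := by positivity
      nlinarith
    rcases hWt with hWt | hWt
    · -- The torus is its own normalizer. Its cell leaves less than `1 / (q d) < 1 / 4`, hence no room
      -- for a further cell, and equality would mean `f = 0`.
      exfalso
      have hpos : (q - 1) / (q * d) + (d - 1) / d = (1 : ℚ) - 1 / (q * d) := by
        field_simp; ring
      have h6 : (1 : ℚ) / (q * d) < 1 / 4 := by
        apply one_div_lt_one_div_of_lt (by norm_num)
        nlinarith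
      have h5 : (0 : ℚ) < 1 / (q * d) := by positivity
      have hall : ∀ y : H, y ∉ Subgroup.center H → y ∉ centralizerCell (unip hz) →
          y ∈ centralizerCell t := by
        intro y hyc hyu
        by_contra hyt
        have h1 := hsum3 y hyc hyu hyt
        have h2 := hquarter y hyc (hcell y hyc hyu)
        have h3 : (0 : ℚ) < 1 / (q * d * (1 + q * f)) := by positivity
        rw [hWt] at h1
        linarith
      have h1 := hcov2 hall
      rw [hWt] at h1
      have h7 : (1 : ℚ) / (4 * (q * d)) = 1 / 4 * (1 / (q * d)) := by field_simp
      linarith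
    · -- The torus has index two in its normalizer. Its cell leaves a proportion strictly between
      -- `1 / 4` and `1 / 2`, so there is exactly one further cell, also with normalizer of index two.
      have hident : (q - 1) / (q * d) + (d - 1) / (2 * d)
          = (1 : ℚ) / 2 + (1 / (2 * d) - 1 / (q * d)) := by
        field_simp; ring
      have h2d : (1 : ℚ) / (2 * d) ≤ 1 / 4 := by
        apply one_div_le_one_div_of_le (by norm_num); linarith
      have hqd : (1 : ℚ) / (4 * (q * d)) = 1 / 4 * (1 / (q * d)) := by field_simp
      have hqd0 : (0 : ℚ) < 1 / (q * d) := by positivity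
      have hlast0 : (0 : ℚ) < 1 / (q * d * (1 + q * f)) := by positivity
      have hqd3 : (1 : ℚ) / (q * d) ≤ 1 / (3 * d) := by
        apply one_div_le_one_div_of_le (by positivity)
        nlinarith
      have h3d : (1 : ℚ) / (3 * d) = 2 / 3 * (1 / (2 * d)) := by field_simp
      have hd0' : (0 : ℚ) < 1 / (2 * d) := by positivity
      have hex : ∃ y : H, y ∉ Subgroup.center H ∧ y ∉ centralizerCell (unip hz) ∧
          y ∉ centralizerCell t := by
        by_contra! hno
        have h1 := hcov2 hno
        rw [hWt] at h1
        linarith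
      obtain ⟨y, hyc, hyu, hyt⟩ := hex
      have hytr := hcell y hyc hyu
      have hy1 := hsum3 y hyc hyu hyt
      rw [hWt] at hy1
      obtain ⟨e, he, hecard, hwy⟩ := hH.weight_semisimple hyc hytr
      have he' : (2 : ℚ) ≤ e := by exact_mod_cast he
      replace hwy : weight y = (e - 1) / (2 * e) := by
        refine hwy.resolve_left fun h => ?_
        have h1 : (1 : ℚ) / 2 ≤ (e - 1) / e := by
          rw [div_le_div_iff₀ (by norm_num) (by positivity)]; linarith
        linarith
      have hall : ∀ w : H, w ∉ Subgroup.center H → w ∉ centralizerCell (unip hz) →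
          w ∉ centralizerCell t → w ∈ centralizerCell y := by
        intro w hwc hwu' hwt
        by_contra hwy'
        have hne1 : unip hz ≠ w := fun h => hwu' (h ▸ self_mem_centralizerCell huc)
        have hne2 : t ≠ w := fun h => hwt (h ▸ self_mem_centralizerCell htc)
        have hne3 : y ≠ w := fun h => hwy' (h ▸ self_mem_centralizerCell hyc)
        have hne4 : unip hz ≠ y := fun h => hyu (h ▸ self_mem_centralizerCell huc)
        have hne5 : t ≠ y := fun h => hyt (h ▸ self_mem_centralizerCell htc)
        have huy : unip hz ∉ centralizerCell y := fun h => hyu (mem_centralizerCell_symm hyc h)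
        have hty : t ∉ centralizerCell y := fun h => hyt (mem_centralizerCell_symm hyc h)
        have huw : unip hz ∉ centralizerCell w := fun h => hwu' (mem_centralizerCell_symm hwc h)
        have htw : t ∉ centralizerCell w := fun h => hwt (mem_centralizerCell_symm hwc h)
        have hyw : y ∉ centralizerCell w := fun h => hwy' (mem_centralizerCell_symm hwc h)
        have h1 := hH.sum_weight_le {unip hz, t, y, w} (by simp [huc, hyc, htc, hwc]) (by
          intro a ha b hb hab
          simp only [Finset.mem_insert, Finset.mem_singleton] at ha hb
          rcases ha with rfl | rfl | rfl | rfl <;> rcases hb with rfl | rfl | rfl | rfl <;>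
            first | assumption | exact absurd rfl hab)
        rw [Finset.sum_insert (by simp [hne, hne1, hne4]),
          Finset.sum_insert (by simp [hne2, hne5]), Finset.sum_pair hne3, hN, hWu, hWt] at h1
        have h2 := hquarter w hwc (hcell w hwc hwu')
        have h3 := hquarter y hyc hytr
        linarith
      have hy2 : (1 : ℚ) ≤ (q - 1) / (q * d) + (weight t + weight y)
          + 1 / (q * d * (1 + q * f)) := by
        have hne4 : unip hz ≠ y := fun h => hyu (h ▸ self_mem_centralizerCell huc)
        have hne5 : t ≠ y := fun h => hyt (h ▸ self_mem_centralizerCell htc)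
        have h1 := hH.one_le_sum_weight {unip hz, t, y} fun w hwc => by
          by_cases hwu' : w ∈ centralizerCell (unip hz)
          · exact ⟨_, by simp, hwu'⟩
          by_cases hwt : w ∈ centralizerCell t
          · exact ⟨t, by simp, hwt⟩
          · exact ⟨y, by simp, hall w hwc hwu' hwt⟩
        rwa [Finset.sum_insert (by simp [hne, hne4]), Finset.sum_pair hne5, hN, hWu] at h1
      rw [hWt] at hy2
      -- equality in the class equation determines the order `2 e` of the last centralizer
      have heq : (d : ℚ) * (1 + q * f) = e * (1 + (q - 2) * f) := by
        have h1 := le_antisymm hy1 hy2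
        rw [hwy] at h1
        field_simp at h1
        have h2 : (q : ℚ) * (d * (1 + q * f)) = q * (e * (1 + (q - 2) * f)) := by
          linear_combination -h1
        exact mul_left_cancel₀ hq0.ne' h2
      have heqN : d * (1 + q * f) = e * (1 + (q - 2) * f) := by
        have h2q : ((q - 2 : ℕ) : ℚ) = q - 2 := by
          rw [Nat.cast_sub (by omega)]; rfl
        rw [← h2q] at heq
        exact_mod_cast heq
      rcases class_equation_arith hq3 hf hdq' hd heqN with h | ⟨h1, h2, h3, h4⟩
      · exact Or.inl h
      · refine Or.inr ⟨h1, h2, h3, t, y, by omega, by omega, ?_⟩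
        intro w hwc hwt
        by_contra! hno
        exact hno.2 (hall w hwc
          (fun h => hwt (tr_sq_of_mem_cell_unip hz0 hz h)) hno.1)

end

end SLTwo

/-! ### The exceptional isomorphism with `SL₂(𝔽₅)` -/

namespace SLTwo

/-- The field with nine elements, as `𝔽₃[ω]` with `ω² = 2`. -/
abbrev NineField := QuadraticAlgebra (ZMod 3) 2 0

/-- The image of `[[1, 1], [0, 1]]` under the embedding of `SL₂(𝔽₅)` into `SL₂(𝔽₉)`. -/
def icoX : SL(2, NineField) := ⟨!![⟨0, 2⟩, ⟨2, 0⟩; ⟨2, 1⟩, ⟨1, 2⟩], by decide⟩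

/-- The image of `[[0, -1], [1, 0]]`. -/
def icoM : SL(2, NineField) := ⟨!![⟨2, 1⟩, ⟨0, 1⟩; ⟨2, 1⟩, ⟨1, 2⟩], by decide⟩

/-- The image of `[[0, 2], [2, 0]]`. -/
def icoN : SL(2, NineField) := ⟨!![⟨0, 2⟩, ⟨0, 2⟩; ⟨0, 0⟩, ⟨0, 1⟩], by decide⟩

/-- The image of the monomial matrix `[[0, -c⁻¹], [c, 0]]`, for nonzero `c`. -/
def icoMonomial (c : ZMod 5) : SL(2, NineField) :=
  if c = 1 then icoM else if c = 2 then icoN else if c = 3 then -icoN else -icoM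

/-- The image of `[[a, b], [c, d]]`, read off from its Bruhat decomposition:
`[[1, a/c], [0, 1]] [[0, -1/c], [c, 0]] [[1, d/c], [0, 1]]` if `c ≠ 0`, and
`[[0, 1], [-1, 0]] [[0, -1/a], [a, 0]] [[1, b/a], [0, 1]]` otherwise. -/
def icoFun (a b c d : ZMod 5) : SL(2, NineField) :=
  if c = 0 then icoMonomial (-1) * icoMonomial a * icoX ^ (b * a⁻¹).val
  else icoX ^ (a * c⁻¹).val * icoMonomial c * icoX ^ (d * c⁻¹).val

theorem icoFun_mul_icoX : ∀ a b c d : ZMod 5, a * d - b * c = 1 →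
    icoFun a (a + b) c (c + d) = icoFun a b c d * icoX := by decide +kernel

theorem icoFun_mul_icoM : ∀ a b c d : ZMod 5, a * d - b * c = 1 →
    icoFun b (-a) d (-c) = icoFun a b c d * icoM := by decide +kernel

theorem icoFun_eq_one : ∀ a b c d : ZMod 5, a * d - b * c = 1 → icoFun a b c d = 1 →
    a = 1 ∧ b = 0 ∧ c = 0 ∧ d = 1 := by decide +kernel

/-- A property of elements of `SL₂(𝔽₅)` stable under products holds everywhere if it holds for the
two standard generators. -/
theorem induction_zmod_five {P : SL(2, ZMod 5) → Prop} (hX : P (matU 1)) (hM : P (matM (ZMod 5)))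
    (hmul : ∀ g h, P g → P h → P (g * h)) (g : SL(2, ZMod 5)) : P g := by
  have hpow : ∀ x, P x → ∀ n : ℕ, P (x ^ (n + 1)) := by
    intro x hx n
    induction n with
    | zero => simpa using hx
    | succ k ih => rw [pow_succ]; exact hmul _ _ ih hx
  have hU : ∀ c : ZMod 5, P (matU c) := by
    intro c
    have : matU c = matU (1 : ZMod 5) ^ ((c - 1).val + 1) := by
      revert c; decide +kernel
    rw [this]; exact hpow _ hX _
  have : Fact (Nat.Prime 5) := ⟨Nat.prime_five⟩
  refine Matrix.SL2.transvection_induction (F := ZMod 5) P ?_ hmul g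
  intro i j hij c
  fin_cases i <;> fin_cases j
  · exact absurd rfl hij
  · exact (transvection_zero_one hij c).symm ▸ hU c
  · have h3 : -matM (ZMod 5) = matM (ZMod 5) ^ (2 + 1) := by decide +kernel
    refine (transvection_one_zero hij c).symm ▸ hmul _ _ (hmul _ _ hM (hU _)) ?_
    rw [h3]
    exact hpow _ hM 2
  · exact absurd rfl hij

/-- The exceptional embedding of `SL₂(𝔽₅)` into `SL₂(𝔽₉)`. -/
def icoHom : SL(2, ZMod 5) →* SL(2, NineField) :=
  MonoidHom.mk' (fun g => icoFun (g 0 0) (g 0 1) (g 1 0) (g 1 1)) <| by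
    have key : ∀ h g : SL(2, ZMod 5), icoFun ((g * h) 0 0) ((g * h) 0 1) ((g * h) 1 0)
        ((g * h) 1 1) = icoFun (g 0 0) (g 0 1) (g 1 0) (g 1 1)
          * icoFun (h 0 0) (h 0 1) (h 1 0) (h 1 1) := by
      intro h
      induction h using induction_zmod_five with
      | hX =>
        intro g
        have h1 : icoFun (matU (1 : ZMod 5) 0 0) (matU (1 : ZMod 5) 0 1) (matU (1 : ZMod 5) 1 0)
          (matU (1 : ZMod 5) 1 1) = icoX := by decide +kernel
        rw [h1, ← icoFun_mul_icoX _ _ _ _ (det_entries g)]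
        simp [mul_entry, matU_00, matU_01, matU_10, matU_11]
      | hM =>
        intro g
        have h1 : icoFun (matM (ZMod 5) 0 0) (matM (ZMod 5) 0 1) (matM (ZMod 5) 1 0)
          (matM (ZMod 5) 1 1) = icoM := by decide +kernel
        rw [h1, ← icoFun_mul_icoM _ _ _ _ (det_entries g)]
        simp [mul_entry, matM_00, matM_01, matM_10, matM_11]
      | hmul h h' ih ih' =>
        intro g
        rw [← mul_assoc, ih', ih, ih', mul_assoc]
    exact fun g h => key h g

theorem icoHom_apply (g : SL(2, ZMod 5)) :
    icoHom g = icoFun (g 0 0) (g 0 1) (g 1 0) (g 1 1) := rfl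

theorem icoHom_injective : Function.Injective icoHom := by
  rw [injective_iff_map_eq_one]
  intro g hg
  obtain ⟨h1, h2, h3, h4⟩ := icoFun_eq_one _ _ _ _ (det_entries g) hg
  exact ext_entries (by rw [h1, one_00]) (by rw [h2, one_01]) (by rw [h3, one_10])
    (by rw [h4, one_11])

/-- The generator `ω` of the field with nine elements. -/
def omegaNine : NineField := ⟨0, 1⟩

theorem icoHom_range : icoHom.range = groupG omegaNine := by
  have hX : icoHom (matU 1) = icoX := by
    rw [icoHom_apply]
    decide +kernel
  have hM : icoHom (matM _) = icoM := by
    rw [icoHom_apply]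
    decide +kernel
  have hV' : icoM ^ 3 * icoX = matV NineField := by decide +kernel
  have hU' : icoM * icoX ^ 4 = matU omegaNine := by decide +kernel
  have hX' : (matV NineField ^ 2 * matU omegaNine) ^ 2 = icoX := by decide +kernel
  have hM' : matU omegaNine * icoX = icoM := by decide +kernel
  have hV : matV NineField ∈ groupG omegaNine := Subgroup.subset_closure (by simp)
  have hU : matU omegaNine ∈ groupG omegaNine := Subgroup.subset_closure (by simp)
  have hXG : icoX ∈ groupG omegaNine := by
    rw [← hX']; exact pow_mem (mul_mem (pow_mem hV 2) hU) 2
  apply le_antisymm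
  · rintro _ ⟨g, rfl⟩
    induction g using induction_zmod_five with
    | hX => rw [hX]; exact hXG
    | hM => rw [hM, ← hM']; exact mul_mem hU hXG
    | hmul g h hg hh => rw [map_mul]; exact mul_mem hg hh
  · rw [groupG, Subgroup.closure_le]
    rintro _ (rfl | rfl)
    · refine ⟨matM _ ^ 3 * matU 1, ?_⟩
      rw [map_mul, map_pow, hX, hM, hV']
    · refine ⟨matM _ * matU 1 ^ 4, ?_⟩
      rw [map_mul, map_pow, hX, hM, hU']

/-- A root `z` of `X² - 2` in an extension of `𝔽₃` gives an embedding of `𝔽₉` carrying `ω` to `z`,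
hence an isomorphism of the groups attached to `ω` and `z`. -/
theorem nonempty_groupG_mulEquiv {E : Type*} [Field E] [Algebra (ZMod 3) E] {z : E}
    (hz : z ^ 2 = 2) : Nonempty (groupG z ≃* SL(2, ZMod 5)) := by
  let φ : NineField →ₐ[ZMod 3] E := QuadraticAlgebra.lift ⟨z, by
    rw [← sq, hz, zero_smul, add_zero, Algebra.smul_def, map_ofNat, mul_one]⟩
  have hφω : φ omegaNine = z := by
    simp [φ, omegaNine, QuadraticAlgebra.lift]
  have hunit : ∀ x : NineField, x ≠ 0 → ∃ y, x * y = 1 := by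
    rintro ⟨a, b⟩ h
    have : ∀ a b : ZMod 3, (⟨a, b⟩ : NineField) ≠ 0 →
      ∃ c d : ZMod 3, (⟨a, b⟩ : NineField) * ⟨c, d⟩ = 1 := by decide +kernel
    obtain ⟨c, d, hcd⟩ := this a b h
    exact ⟨_, hcd⟩
  have hφ : Function.Injective φ := by
    rw [injective_iff_map_eq_zero]
    intro x hx
    by_contra h
    obtain ⟨y, hy⟩ := hunit x h
    have := congrArg φ hy
    rw [map_mul, hx, zero_mul, map_one] at this
    exact zero_ne_one this
  let Φ : SL(2, NineField) →* SL(2, E) := Matrix.SpecialLinearGroup.map φ.toRingHom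
  have hΦe : ∀ (x : SL(2, NineField)) (i j : Fin 2), Φ x i j = φ (x i j) := fun _ _ _ => rfl
  have hΦ : Function.Injective Φ := by
    intro x y hxy
    have he : ∀ i j, x i j = y i j := fun i j =>
      hφ (congrArg (fun m : SL(2, E) => m i j) hxy)
    exact Matrix.SpecialLinearGroup.ext _ _ he
  have hV : Φ (matV NineField) = matV E := by
    apply ext_entries
    · rw [hΦe, matV_00, matV_00, map_zero]
    · rw [hΦe, matV_01, matV_01, map_one]
    · rw [hΦe, matV_10, matV_10, map_neg, map_one]
    · rw [hΦe, matV_11, matV_11, map_ofNat]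
  have hU : Φ (matU omegaNine) = matU z := by
    apply ext_entries
    · rw [hΦe, matU_00, matU_00, map_one]
    · rw [hΦe, matU_01, matU_01, hφω]
    · rw [hΦe, matU_10, matU_10, map_zero]
    · rw [hΦe, matU_11, matU_11, map_one]
  have hG : (Φ.comp icoHom).range = groupG z := by
    rw [MonoidHom.range_comp, icoHom_range, groupG, MonoidHom.map_closure, Set.image_pair, hV, hU,
      groupG]
  rw [← hG]
  exact ⟨(MonoidHom.ofInjective (f := Φ.comp icoHom) (hΦ.comp icoHom_injective)).symm⟩

end SLTwo

/-! ### Identification of the group -/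

namespace SLTwo

section

variable {E : Type*} [Field E]

/-- The group `groupG z` enlarged by `-1`. -/
def signedGroup (z : E) : Subgroup SL(2, E) := Subgroup.closure {matV E, matU z, -1}

theorem matV_mem_signedGroup (z : E) : matV E ∈ signedGroup z :=
  Subgroup.subset_closure (by simp)

theorem matU_mem_signedGroup (z : E) : matU z ∈ signedGroup z :=
  Subgroup.subset_closure (by simp)

theorem signedGroup_admissible {z : E} (h2 : (2 : E) ≠ 0) (hz : z ≠ 0) :
    Admissible (signedGroup z) where
  two_ne_zero := h2
  neg_one_mem := Subgroup.subset_closure (by simp)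
  exists_matU := ⟨z, hz, matU_mem_signedGroup z⟩
  exists_lower := ⟨matV E, matV_mem_signedGroup z, by simp [matV_10]⟩

theorem mem_or_neg_mem_of_mem_signedGroup {z : E} {g : SL(2, E)} (hg : g ∈ signedGroup z) :
    g ∈ groupG z ∨ -g ∈ groupG z := by
  induction hg using Subgroup.closure_induction with
  | mem x hx =>
    rcases hx with rfl | rfl | rfl
    · exact Or.inl (Subgroup.subset_closure (by simp))
    · exact Or.inl (Subgroup.subset_closure (by simp))
    · exact Or.inr (by rw [neg_neg]; exact one_mem _)
  | one => exact Or.inl (one_mem _)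
  | mul x y _ _ hx hy =>
    rcases hx with hx | hx <;> rcases hy with hy | hy
    · exact Or.inl (mul_mem hx hy)
    · exact Or.inr (by rw [← mul_neg]; exact mul_mem hx hy)
    · exact Or.inr (by rw [← neg_mul]; exact mul_mem hx hy)
    · exact Or.inl (by rw [← neg_mul_neg]; exact mul_mem hx hy)
  | inv x _ hx =>
    rcases hx with hx | hx
    · exact Or.inl (inv_mem hx)
    · refine Or.inr ?_
      have h : -x⁻¹ = (-x)⁻¹ := by
        rw [eq_inv_iff_mul_eq_one, neg_mul_neg, inv_mul_cancel]
      rw [h]; exact inv_mem hx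

/-- The sign is irrelevant for elements of odd order `p`: `(-g) ^ (p + 1) = g`. -/
theorem mem_groupG_of_pow_char {p : ℕ} (hp : Odd p) {z : E} {g : SL(2, E)} (hgp : g ^ p = 1)
    (hg : g ∈ signedGroup z) : g ∈ groupG z := by
  rcases mem_or_neg_mem_of_mem_signedGroup hg with h | h
  · exact h
  · have h1 := pow_mem h (p + 1)
    rwa [hp.add_one.neg_pow, pow_succ, hgp, one_mul] at h1

theorem eq_top_of_forall_matU_mem {G : Subgroup SL(2, E)} (hV : matV E ∈ G)
    (hU : ∀ a : E, matU a ∈ G) : G = ⊤ := by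
  rw [eq_top_iff]
  intro g _
  have hM' : -matM E ∈ G := by
    have h : matV E * matU 2 = -matM E := by
      apply ext_entries <;>
        simp [mul_entry, neg_entry, matU_00, matU_01, matU_10, matU_11, matM_00, matM_01, matM_10,
          matM_11, matV_00, matV_01, matV_10, matV_11]
    rw [← h]; exact mul_mem hV (hU 2)
  have hM : matM E ∈ G := by
    have h : (-matM E)⁻¹ = matM E := by
      apply ext_entries <;>
        simp only [inv_00, inv_01, inv_10, inv_11, neg_entry, matM_00, matM_01, matM_10, matM_11,
          neg_zero, neg_neg]
    rw [← h]; exact inv_mem hM'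
  refine Matrix.SL2.transvection_induction (F := E) (fun x => x ∈ G) ?_
    (fun _ _ => mul_mem) g
  intro i j hij c
  fin_cases i <;> fin_cases j
  · exact absurd rfl hij
  · exact (transvection_zero_one hij c).symm ▸ hU c
  · exact (transvection_one_zero hij c).symm ▸ mul_mem (mul_mem hM (hU _)) hM'
  · exact absurd rfl hij

/-- An additive subgroup containing `1` and closed under inversion is a subfield in characteristic
not `2`: products are recovered from `a - a² = (a⁻¹ + (1 - a)⁻¹)⁻¹` by polarization. -/
theorem mul_mem_of_inv_mem (h2 : (2 : E) ≠ 0) {A : AddSubgroup E} (h1 : (1 : E) ∈ A)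
    (hinv : ∀ a ∈ A, a⁻¹ ∈ A) {a b : E} (ha : a ∈ A) (hb : b ∈ A) : a * b ∈ A := by
  have hsq : ∀ c ∈ A, c ^ 2 ∈ A := by
    intro c hc
    by_cases hc0 : c = 0
    · rw [hc0]; simp [A.zero_mem]
    by_cases hc1 : c = 1
    · rw [hc1]; simpa using h1
    have hc1' : 1 - c ≠ 0 := sub_ne_zero.2 (Ne.symm hc1)
    have h3 := A.sub_mem hc (hinv _ (A.add_mem (hinv c hc) (hinv _ (A.sub_mem h1 hc))))
    have h4 : c - (c⁻¹ + (1 - c)⁻¹)⁻¹ = c ^ 2 := by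
      have : c⁻¹ + (1 - c)⁻¹ = (c * (1 - c))⁻¹ := by field_simp; ring
      rw [this, inv_inv]; ring
    rwa [h4] at h3
  have hhalf : ∀ c ∈ A, c / 2 ∈ A := by
    intro c hc
    have h3 := hinv _ (A.add_mem (hinv c hc) (hinv c hc))
    have h4 : (c⁻¹ + c⁻¹)⁻¹ = c / 2 := by
      rw [← two_mul, mul_inv, inv_inv]; ring
    rwa [h4] at h3
  have h5 := hhalf _ (A.sub_mem (A.sub_mem (hsq _ (A.add_mem ha hb)) (hsq a ha)) (hsq b hb))
  have h6 : ((a + b) ^ 2 - a ^ 2 - b ^ 2) / 2 = a * b := by field_simp; ring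
  rwa [h6] at h5

/-- If the orbit of infinity has `|A| + 1` points, where `A` is the root group, then its finite
points are the elements of `A`, and the Möbius transformation of `matV E` shows that `A` is closed
under inversion. -/
theorem rootGroup_inv_mem [Finite E] {p : ℕ} [Fact p.Prime] [CharP E p] {z : E}
    (hH : Admissible (signedGroup z))
    (hcard : Nat.card (finiteOrbit (signedGroup z)) = Nat.card (rootGroup (signedGroup z))) :
    1 ∈ rootGroup (signedGroup z) ∧
      ∀ a ∈ rootGroup (signedGroup z), a⁻¹ ∈ rootGroup (signedGroup z) := by
  have hV := matV_mem_signedGroup z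
  have h0 : (0 : E) ∈ finiteOrbit (signedGroup z) := by
    have := smul_mem_orbit hV (MulAction.mem_orbit_self (M := signedGroup z)
      (OnePoint.infty : OnePoint E))
    rw [smul_infty, if_neg (by simp [matV_10])] at this
    simpa [mem_finiteOrbit, matV_00, matV_10] using this
  have hsub : (rootGroup (signedGroup z) : Set E) ⊆ finiteOrbit (signedGroup z) := by
    intro a ha
    have := add_mem_finiteOrbit h0 ha
    rwa [zero_add] at this
  have heq : (rootGroup (signedGroup z) : Set E) = finiteOrbit (signedGroup z) :=
    Set.eq_of_subset_of_ncard_le hsub hcard.le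
  have h1 : (1 : E) ∈ rootGroup (signedGroup z) := by
    -- the only fixed point of `matV E` on the projective line is `1`
    obtain ⟨h, hh⟩ := hH.exists_fixed_of_pow_char (p := p) (y := ⟨matV E, hV⟩)
      (Subtype.ext (pow_char_eq_one (by simp [tr, matV_00, matV_11])))
    have hfix : matV E • (h • (OnePoint.infty : OnePoint E)) = h • OnePoint.infty :=
      inv_smul_eq_iff.1 hh
    have hmem : h • (OnePoint.infty : OnePoint E) ∈
        MulAction.orbit (signedGroup z) (OnePoint.infty : OnePoint E) := MulAction.mem_orbit _ h
    generalize h • (OnePoint.infty : OnePoint E) = ω at hfix hmem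
    induction ω using OnePoint.rec with
    | infty =>
      rw [smul_infty_eq_iff, matV_10] at hfix
      simp at hfix
    | coe k =>
      rw [smul_coe] at hfix
      split_ifs at hfix with hk
      · exact absurd hfix (OnePoint.infty_ne_coe k)
      · rw [OnePoint.coe_eq_coe, div_eq_iff hk, matV_00, matV_01, matV_10, matV_11] at hfix
        have h3 : (k - 1) ^ 2 = 0 := by linear_combination hfix
        have h4 : k = 1 := sub_eq_zero.1 (pow_eq_zero_iff _root_.two_ne_zero |>.1 h3)
        rw [← SetLike.mem_coe, heq, ← h4]
        exact hmem
  refine ⟨h1, fun a ha => ?_⟩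
  by_cases ha0 : a = 0
  · rw [ha0, _root_.inv_zero]; exact zero_mem _
  have h2 : 2 - a ∈ rootGroup (signedGroup z) := by
    have := sub_mem (add_mem h1 h1) ha
    rwa [one_add_one_eq_two] at this
  have h3 := smul_mem_orbit hV (hsub h2)
  have h4 : matV E 1 0 * (2 - a) + matV E 1 1 = a := by rw [matV_10, matV_11]; ring
  rw [smul_coe, h4, if_neg ha0, matV_00, matV_01, zero_mul, zero_add, one_div] at h3
  rw [← SetLike.mem_coe, heq]
  exact h3

theorem groupG_eq_top_of_card [Finite E] {p : ℕ} [Fact p.Prime] (hp : 3 ≤ p) [Algebra (ZMod p) E]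
    [CharP E p] {z : E} (h2 : (2 : E) ≠ 0) (hz : z ≠ 0)
    (hE : IntermediateField.adjoin (ZMod p) {z} = ⊤)
    (hcard : Nat.card (finiteOrbit (signedGroup z)) = Nat.card (rootGroup (signedGroup z))) :
    groupG z = ⊤ := by
  obtain ⟨h1, hinv⟩ := rootGroup_inv_mem (p := p) (signedGroup_admissible h2 hz) hcard
  let S : Subfield E :=
    { carrier := rootGroup (signedGroup z)
      mul_mem' := fun ha hb => mul_mem_of_inv_mem h2 h1 hinv ha hb
      one_mem' := h1
      add_mem' := fun ha hb => add_mem ha hb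
      zero_mem' := zero_mem _
      neg_mem' := fun ha => neg_mem ha
      inv_mem' := fun a ha => hinv a ha }
  let F : IntermediateField (ZMod p) E := S.toIntermediateField fun x => by
    rw [← ZMod.natCast_zmod_val x, map_natCast]
    exact natCast_mem S _
  have hF : F = ⊤ := by
    rw [eq_top_iff, ← hE, IntermediateField.adjoin_le_iff, Set.singleton_subset_iff]
    exact matU_mem_signedGroup z
  have hodd : Odd p := (Fact.out : p.Prime).odd_of_ne_two (by omega)
  apply eq_top_of_forall_matU_mem (Subgroup.subset_closure (by simp))
  intro a
  refine mem_groupG_of_pow_char hodd (pow_char_eq_one (by simp [tr, matU_00, matU_11]; norm_num)) ?_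
  have ha : a ∈ F := hF ▸ IntermediateField.mem_top
  exact ha

/-! ### The exceptional configuration -/

/-- With `τ` the trace of `x`, the matrix `x ^ 5 - (τ⁴ - 3 τ² + 1) x` is scalar. -/
theorem pow_five_entries (x : SL(2, E)) :
    (x ^ 5) 0 1 = (tr x ^ 4 - 3 * tr x ^ 2 + 1) * x 0 1 ∧
    (x ^ 5) 1 0 = (tr x ^ 4 - 3 * tr x ^ 2 + 1) * x 1 0 ∧
    (x ^ 5) 0 0 - (x ^ 5) 1 1 = (tr x ^ 4 - 3 * tr x ^ 2 + 1) * (x 0 0 - x 1 1) := by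
  have hd := det_entries x
  have hpow : x ^ 5 = x * x * (x * x) * x := by simp [pow_succ, mul_assoc]
  have h00 : (x * x) 0 0 = tr x * x 0 0 - 1 := by rw [mul_entry, tr]; linear_combination -hd
  have h01 : (x * x) 0 1 = tr x * x 0 1 := by rw [mul_entry, tr]; ring
  have h10 : (x * x) 1 0 = tr x * x 1 0 := by rw [mul_entry, tr]; ring
  have h11 : (x * x) 1 1 = tr x * x 1 1 - 1 := by rw [mul_entry, tr]; linear_combination -hd
  rw [hpow]
  simp only [mul_entry (x * x * (x * x)) x, mul_entry (x * x) (x * x), h00, h01, h10, h11]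
  have ht : tr x = x 0 0 + x 1 1 := rfl
  have h11' : x 1 1 = tr x - x 0 0 := by rw [ht]; ring
  have hd' : x 0 1 * x 1 0 = x 0 0 * (tr x - x 0 0) - 1 := by rw [← h11']; linear_combination -hd
  generalize tr x = τ at *
  rw [h11']
  generalize x 0 0 = a at *
  generalize x 0 1 = b at *
  generalize x 1 0 = c at *
  refine ⟨?_, ?_, ?_⟩
  · linear_combination τ ^ 2 * b * hd'
  · linear_combination τ ^ 2 * c * hd'
  · linear_combination τ ^ 2 * (2 * a - τ) * hd'

theorem tr_of_pow_ten {x : SL(2, E)} (h2 : (2 : E) ≠ 0) (h1 : x ≠ 1) (h1' : x ≠ -1)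
    (h : x ^ 10 = 1) : tr x ^ 4 - 3 * tr x ^ 2 + 1 = 0 := by
  have h5 : (x ^ 5) ^ 2 = 1 := by rw [← pow_mul]; exact h
  obtain ⟨e1, e2, e3⟩ := pow_five_entries x
  have hs : (x ^ 5) 0 1 = 0 ∧ (x ^ 5) 1 0 = 0 ∧ (x ^ 5) 0 0 - (x ^ 5) 1 1 = 0 := by
    rcases eq_one_or_neg_one_of_sq h2 h5 with h | h <;> rw [h] <;> simp
  rw [hs.1] at e1
  rw [hs.2.1] at e2
  rw [hs.2.2] at e3
  rcases nonscalar h1 h1' with hx | hx | hx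
  · exact (mul_eq_zero.1 e1.symm).resolve_right hx
  · exact (mul_eq_zero.1 e2.symm).resolve_right hx
  · exact (mul_eq_zero.1 e3.symm).resolve_right (sub_ne_zero.2 hx)

theorem tr_of_pow_four {x : SL(2, E)} (h2 : (2 : E) ≠ 0) (h1 : x ≠ 1) (h1' : x ≠ -1)
    (h : x ^ 4 = 1) : tr x = 0 := by
  have h5 : (x ^ 2) ^ 2 = 1 := by rw [← pow_mul]; exact h
  rcases eq_one_or_neg_one_of_sq h2 h5 with h6 | h6
  · exact absurd (eq_one_or_neg_one_of_sq h2 h6) (by simp [h1, h1'])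
  · rw [sq] at h6
    have hd := det_entries x
    have e00 := congrArg (fun m : SL(2, E) => m 0 0) h6
    have e11 := congrArg (fun m : SL(2, E) => m 1 1) h6
    simp only [mul_entry, neg_entry, one_00, one_11] at e00 e11
    have h00 : tr x * x 0 0 = 0 := by rw [tr]; linear_combination e00 + hd
    have h11 : tr x * x 1 1 = 0 := by rw [tr]; linear_combination e11 + hd
    have : tr x * tr x = 0 := by
      nth_rewrite 2 [tr]; linear_combination h00 + h11
    exact mul_self_eq_zero.1 this

theorem pow_card_centralizer_eq_one {G : Type*} [Group G] {t w : G}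
    (hw : w ∈ centralizerCell t) : w ^ Nat.card (Subgroup.centralizer {t}) = 1 := by
  obtain ⟨-, h, hh⟩ := hw
  have h1 : (⟨_, hh⟩ : Subgroup.centralizer {t}) ^ Nat.card (Subgroup.centralizer {t}) = 1 :=
    pow_card_eq_one'
  have h2 : (h * w * h⁻¹) ^ Nat.card (Subgroup.centralizer {t}) = 1 := congrArg Subtype.val h1
  rw [conj_pow, mul_inv_eq_one] at h2
  simpa using h2

/-- In the exceptional configuration the characteristic is `3`, and the traces `2 ± z` of the
products of the generators are constrained so strongly that `z² = 2`. -/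
theorem eq_of_exceptional [Finite E] {p : ℕ} [Fact p.Prime] [Algebra (ZMod p) E]
    [CharP E p] {z : E} (h2 : (2 : E) ≠ 0) (hz : z ≠ 0)
    (hE : IntermediateField.adjoin (ZMod p) {z} = ⊤)
    (hq : Nat.card (rootGroup (signedGroup z)) = 3)
    (hcard : Nat.card (finiteOrbit (signedGroup z)) = 9)
    (hcells : ∃ t y : signedGroup z,
        Nat.card (Subgroup.centralizer {t}) = 4 ∧ Nat.card (Subgroup.centralizer {y}) = 10 ∧
        ∀ w : signedGroup z, w ∉ Subgroup.center (signedGroup z) → tr (w : SL(2, E)) ^ 2 ≠ 4 →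
          w ∈ centralizerCell t ∨ w ∈ centralizerCell y) :
    p = 3 ∧ z ^ 2 = 2 := by
  have hH := signedGroup_admissible h2 hz
  have hp : p = 3 := by
    have h1 : addOrderOf (⟨z, matU_mem_signedGroup z⟩ : rootGroup (signedGroup z)) ∣ 3 := by
      rw [← hq]; exact addOrderOf_dvd_natCard _
    rw [addOrderOf_eq_prime (p := p) (by apply Subtype.ext; simp)
      (fun h => hz (congrArg Subtype.val h))] at h1
    exact (Nat.prime_dvd_prime_iff_eq Fact.out Nat.prime_three).1 h1
  subst hp
  refine ⟨rfl, ?_⟩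
  have h3 : (3 : E) = 0 := by exact_mod_cast CharP.cast_eq_zero E 3
  obtain ⟨t, y, ht, hy, hall⟩ := hcells
  have hcases : ∀ w ∈ signedGroup z, tr w * (tr w ^ 2 - 4) * (tr w ^ 4 + 1) = 0 := by
    intro w hw
    by_cases h4 : tr w ^ 2 = 4
    · rw [h4]; ring
    have hne : w ≠ 1 ∧ w ≠ -1 := by
      constructor <;> rintro rfl <;> apply h4
      · simp only [tr, one_00, one_11]; norm_num
      · simp only [tr, neg_entry, one_00, one_11]; norm_num
    have hc : (⟨w, hw⟩ : signedGroup z) ∉ Subgroup.center _ := by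
      rw [hH.mem_center_iff]
      exact fun h => h.elim hne.1 hne.2
    rcases hall ⟨w, hw⟩ hc h4 with h | h
    · have h5 := pow_card_centralizer_eq_one h
      rw [ht] at h5
      rw [tr_of_pow_four h2 hne.1 hne.2 (congrArg Subtype.val h5)]
      ring
    · have h5 := pow_card_centralizer_eq_one h
      rw [hy] at h5
      have h6 := tr_of_pow_ten h2 hne.1 hne.2 (congrArg Subtype.val h5)
      have h7 : tr w ^ 4 + 1 = 0 := by linear_combination h6 + tr w ^ 2 * h3
      rw [h7, mul_zero]
  -- `z` is not in the prime field, which has fewer points than the orbit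
  have hprime : ∀ c : ZMod 3, algebraMap (ZMod 3) E c ≠ z := by
    intro c hc
    have hbot : IntermediateField.adjoin (ZMod 3) {z} = ⊥ := by
      rw [IntermediateField.adjoin_simple_eq_bot_iff, IntermediateField.mem_bot]
      exact ⟨c, hc⟩
    have hsurj : Function.Surjective (algebraMap (ZMod 3) E) := by
      intro e
      have he : e ∈ (⊥ : IntermediateField (ZMod 3) E) := by
        rw [← hbot, hE]; exact IntermediateField.mem_top
      exact IntermediateField.mem_bot.1 he
    have h4 := Nat.card_le_card_of_surjective _ hsurj
    have h5 : Nat.card (finiteOrbit (signedGroup z)) ≤ Nat.card E :=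
      Nat.card_le_card_of_injective _ Subtype.val_injective
    rw [Nat.card_zmod] at h4
    omega
  have hz1 : z - 1 ≠ 0 := fun h => hprime 1 (by rw [map_one]; linear_combination -h)
  have hz2 : z + 1 ≠ 0 := fun h => hprime (-1) (by rw [map_neg, map_one]; linear_combination -h)
  have hV := matV_mem_signedGroup z
  have hU := matU_mem_signedGroup z
  have e1 := hcases _ (mul_mem hV hU)
  have e2 := hcases _ (mul_mem hV (inv_mem hU))
  have t1 : tr (matV E * matU z) = -(z + 1) := by
    simp only [tr, mul_entry, matV_00, matV_01, matV_10, matV_11, matU_00, matU_01, matU_10,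
      matU_11]
    linear_combination h3
  have t2 : tr (matV E * (matU z)⁻¹) = z - 1 := by
    simp only [tr, mul_entry, inv_00, inv_01, inv_10, inv_11, matV_00, matV_01, matV_10, matV_11,
      matU_00, matU_01, matU_10, matU_11]
    linear_combination h3
  rw [t1] at e1
  rw [t2] at e2
  have f1 : (-(z + 1)) ^ 2 - 4 = z * (z - 1) := by linear_combination (z - 1) * h3
  have f2 : (z - 1) ^ 2 - 4 = z * (z + 1) := by linear_combination (-z - 1) * h3
  rw [f1] at e1
  rw [f2] at e2
  have g1 := (mul_eq_zero.1 e1).resolve_left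
    (mul_ne_zero (neg_ne_zero.2 hz2) (mul_ne_zero hz hz1))
  have g2 := (mul_eq_zero.1 e2).resolve_left (mul_ne_zero hz1 (mul_ne_zero hz hz2))
  apply mul_left_cancel₀ hz
  linear_combination g2 - g1 + (3 * z ^ 3 + 2 * z) * h3

end

end SLTwo

open SLTwo in
theorem mainTheorem2 (p : ℕ) [Fact p.Prime] (hp : 3 ≤ p)
    {E : Type*} [Field E] [Finite E] [Algebra (ZMod p) E]
    (z : E) (hz : z ≠ 0) (hE : IntermediateField.adjoin (ZMod p) {z} = ⊤) :
    ((p = 3 ∧ z ^ 2 = 2) →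
      Nonempty (groupG z ≃* Matrix.SpecialLinearGroup (Fin 2) (ZMod 5))) ∧
    (¬(p = 3 ∧ z ^ 2 = 2) → groupG z = ⊤) := by
  have : CharP E p := charP_of_injective_algebraMap (algebraMap (ZMod p) E).injective p
  have h2 : (2 : E) ≠ 0 := Ring.two_ne_zero (by rw [ringChar.eq E p]; omega)
  constructor
  · rintro ⟨rfl, hz2⟩
    exact nonempty_groupG_mulEquiv hz2
  · intro hne
    rcases (signedGroup_admissible h2 hz).card_finiteOrbit_or_exceptional (p := p) hp with
      h | ⟨h3, h9, hcells⟩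
    · exact groupG_eq_top_of_card hp h2 hz hE h
    · exact absurd (eq_of_exceptional h2 hz hE h3 h9 hcells) hne
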